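/- All algebras, coalgebras and tensor products are over a field $k$, and Sweedler notation is used. A *right $H$-Galois object* over a Hopf algebra $H$ is a right $H$-comodule algebra $A$ whose coinvariants $\{a\in A : a_{(0)}\otimes a_{(1)}=a\otimes 1\}$ are equal to $k$ (in particular $A\neq 0$) and whose Galois map $A\otimes A\to A\otimes H$, $a\otimes b\mapsto ab_{(0)}\otimes b_{(1)}$, is bijective. A *twisting map* for algebras $A,R$ is a linear map $\theta\colon R\otimes A\to A\otimes R$ such that $(m_A\otimes m_R)\circ(\mathrm{id}_A\otimes\theta\otimes\mathrm{id}_R)$ makes $A\otimes R$ an associative algebra with unit $1\otimes 1$; this algebra is denoted $A\#_\theta R$. A *matched pair of Hopf algebras* $(H,U,\triangleright,\triangleleft)$ consists of Hopf algebras $H,U$ and coalgebra maps $\triangleright\colon U\otimes H\to H$, $\triangleleft\colon U\otimes H\to U$ such that $\triangleright$ is a left action of the algebra $U$ on $H$, $\triangleleft$ is a right action of the algebra $H$ on $U$ and, for $x,y\in U$, $a,b\in H$, $$x\triangleright 1=\varepsilon(x)1,\qquad 1\triangleleft a=\varepsilon(a)1,$$ $$x\triangleright(ab)=(x_{(1)}\triangleright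 a_{(1)})\big((x_{(2)}\triangleleft a_{(2)})\triangleright b\big),\qquad (yx)\triangleleft a=\big(y\triangleleft(x_{(1)}\triangleright a_{(1)})\big)(x_{(2)}\triangleleft a_{(2)}),$$ $$y_{(1)}\triangleleft a_{(1)}\otimes y_{(2)}\triangleright a_{(2)}=y_{(2)}\triangleleft a_{(2)}\otimes y_{(1)}\triangleright a_{(1)}.$$ Put $\omega\colon U\otimes H\to H\otimes U$, $\omega(x\otimes a)=x_{(1)}\triangleright a_{(1)}\otimes x_{(2)}\triangleleft a_{(2)}$. The *bicrossed product* $E=H\bowtie U$ is the Hopf algebra with underlying coalgebra $H\otimes U$ and multiplication $(a\bowtie x)(b\bowtie y)=a(x_{(1)}\triangleright b_{(1)})\bowtie(x_{(2)}\triangleleft b_{(2)})y$. **Theorem.** Let $(H,U,\triangleright,\triangleleft)$ be a matched pair of Hopf algebras and $E=H\bowtie U$. For a right $H$-Galois object $A$ and a right $U$-Galois object $R$, call a twisting map $\theta\colon R\otimes A\to A\otimes R$ *compatible* if $$\rho_{A\otimes R}\circ\theta=(\theta\otimes\omega)\circ\rho_{R\otimes A},$$ where $\rho_{A\otimes R}(a\otimes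 r)=a_{(0)}\otimes r_{(0)}\otimes a_{(1)}\otimes r_{(1)}$ and $\rho_{R\otimes A}(r\otimes a)=r_{(0)}\otimes a_{(0)}\otimes r_{(1)}\otimes a_{(1)}$. 1. Let $A$ be a right $H$-Galois object, $R$ a right $U$-Galois object and $\theta\colon R\otimes A\to A\otimes R$ a compatible twisting map. Then $A\#_\theta R$ is a right $E$-Galois object with the coaction $a\# r\mapsto a_{(0)}\# r_{(0)}\otimes a_{(1)}\bowtie r_{(1)}$. 2. Let $A,A'$ be right $H$-Galois objects, $R,R'$ right $U$-Galois objects, and $\theta\colon R\otimes A\to A\otimes R$, $\theta'\colon R'\otimes A'\to A'\otimes R'$ compatible twisting maps. Then the right $E$-Galois objects $A\#_\theta R$ and $A'\#_{\theta'}R'$ are isomorphic (as right $E$-comodule algebras) if and only if there exist an isomorphism of right $H$-comodule algebras $f\colon A\to A'$ and an isomorphism of right $U$-comodule algebras $g\colon R\to R'$ such that $(f\otimes g)\circ\theta=\theta'\circ(g\otimes f)$. 3. Conversely, every right $E$-Galois object is isomorphic, as a right $E$-comodule algebra, to $A\#_\theta R$ for some right $H$-Galois object $A$, some right $U$-Galois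 object $R$ and some compatible twisting map $\theta\colon R\otimes A\to A\otimes R$. -/

import Mathlib

open scoped TensorProduct

namespace HopfGalois

noncomputable section

universe u v w

/-! ### Twisted tensor products of algebras -/

section Twisting

variable {k : Type u} [Field k] {A : Type v} {R : Type w} [Ring A] [Algebra k A]
  [Ring R] [Algebra k R]

/-- For a linear map `θ : R ⊗ A → A ⊗ R`, the map
`A ⊗ R ⊗ A ⊗ R --(id ⊗ θ ⊗ id)--> A ⊗ A ⊗ R ⊗ R --(m_A ⊗ m_R)--> A ⊗ R`. -/
def twistedMulMap (θ : R ⊗[k] A →ₗ[k] A ⊗[k] R) :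
    (A ⊗[k] R) ⊗[k] (A ⊗[k] R) →ₗ[k] A ⊗[k] R :=
  TensorProduct.map (LinearMap.mul' k A) (LinearMap.mul' k R) ∘ₗ
    (TensorProduct.assoc k A A (R ⊗[k] R)).symm.toLinearMap ∘ₗ
    (TensorProduct.assoc k A R R).toLinearMap.lTensor A ∘ₗ
    (θ.rTensor R).lTensor A ∘ₗ
    (TensorProduct.assoc k R A R).symm.toLinearMap.lTensor A ∘ₗ
    (TensorProduct.assoc k A R (A ⊗[k] R)).toLinearMap

/-- The multiplication on `A ⊗ R` defined by `θ`, as a bilinear map. -/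
def twistedMul (θ : R ⊗[k] A →ₗ[k] A ⊗[k] R) :
    A ⊗[k] R →ₗ[k] A ⊗[k] R →ₗ[k] A ⊗[k] R :=
  TensorProduct.curry (twistedMulMap θ)

theorem twistedMul_tmul (θ : R ⊗[k] A →ₗ[k] A ⊗[k] R) (a b : A) (r s : R) :
    twistedMul θ (a ⊗ₜ r) (b ⊗ₜ s) =
      TensorProduct.map (LinearMap.mulLeft k a) (LinearMap.mulRight k s) (θ (r ⊗ₜ b)) := by
  simp only [twistedMul, twistedMulMap, TensorProduct.curry_apply, LinearMap.comp_apply,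
    LinearEquiv.coe_coe, TensorProduct.assoc_tmul, LinearMap.lTensor_tmul,
    TensorProduct.assoc_symm_tmul, LinearMap.rTensor_tmul]
  induction θ (r ⊗ₜ[k] b) with
  | zero => simp
  | add x y hx hy => simp only [TensorProduct.add_tmul, TensorProduct.tmul_add, map_add, hx, hy]
  | tmul x y => simp

variable (k A R) in
/-- A twisting map for `A`, `R`: a linear map `θ : R ⊗ A → A ⊗ R` such that the multiplication
`(m_A ⊗ m_R) ∘ (id ⊗ θ ⊗ id)` makes `A ⊗ R` an associative algebra with unit `1 ⊗ 1`. -/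
structure TwistingMap where
  /-- the underlying linear map -/
  toLinearMap : R ⊗[k] A →ₗ[k] A ⊗[k] R
  mul_assoc : ∀ x y z : A ⊗[k] R,
    twistedMul toLinearMap (twistedMul toLinearMap x y) z =
      twistedMul toLinearMap x (twistedMul toLinearMap y z)
  one_mul : ∀ x : A ⊗[k] R, twistedMul toLinearMap (1 ⊗ₜ 1) x = x
  mul_one : ∀ x : A ⊗[k] R, twistedMul toLinearMap x (1 ⊗ₜ 1) = x

/-- The twisted tensor product `A #_θ R`: the vector space `A ⊗ R` with the multiplication
defined by the twisting map `θ`. -/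
def TwistedTensor (_θ : TwistingMap k A R) : Type (max v w) := A ⊗[k] R

namespace TwistedTensor

variable (θ : TwistingMap k A R)

instance : AddCommGroup (TwistedTensor θ) := inferInstanceAs (AddCommGroup (A ⊗[k] R))

instance : Module k (TwistedTensor θ) := inferInstanceAs (Module k (A ⊗[k] R))

/-- The identity map `A ⊗ R → A #_θ R`. -/
def of : A ⊗[k] R ≃ₗ[k] TwistedTensor θ := LinearEquiv.refl k (A ⊗[k] R)

instance : Mul (TwistedTensor θ) :=
  ⟨fun x y => of θ (twistedMul θ.toLinearMap ((of θ).symm x) ((of θ).symm y))⟩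

instance : One (TwistedTensor θ) := ⟨of θ (1 ⊗ₜ 1)⟩

theorem of_mul_of (x y : A ⊗[k] R) :
    of θ x * of θ y = of θ (twistedMul θ.toLinearMap x y) := rfl

theorem one_eq : (1 : TwistedTensor θ) = of θ (1 ⊗ₜ 1) := rfl

instance : Ring (TwistedTensor θ) where
  __ := (inferInstance : AddCommGroup (TwistedTensor θ))
  left_distrib x y z := congrArg (of θ) (map_add (twistedMul θ.toLinearMap ((of θ).symm x)) _ _)
  right_distrib x y z := congrArg (of θ) (LinearMap.map_add₂ (twistedMul θ.toLinearMap) _ _ _)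
  zero_mul x := congrArg (of θ) (LinearMap.map_zero₂ (twistedMul θ.toLinearMap) _)
  mul_zero x := congrArg (of θ) (map_zero (twistedMul θ.toLinearMap ((of θ).symm x)))
  mul_assoc x y z := θ.mul_assoc x y z
  one_mul x := θ.one_mul x
  mul_one x := θ.mul_one x

instance : Algebra k (TwistedTensor θ) :=
  Algebra.ofModule
    (fun c _ _ => congrArg (of θ) (LinearMap.map_smul₂ (twistedMul θ.toLinearMap) c _ _))
    (fun c x _ => congrArg (of θ) (map_smul (twistedMul θ.toLinearMap ((of θ).symm x)) c _))

end TwistedTensor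

/-- Sufficient conditions for a linear map to be a twisting map. -/
theorem twistedMul_assoc_of (θ : R ⊗[k] A →ₗ[k] A ⊗[k] R)
    (h₁ : ∀ x y a, θ ((x * y) ⊗ₜ a) = twistedMul θ (1 ⊗ₜ x) (θ (y ⊗ₜ a)))
    (h₂ : ∀ x a b, θ (x ⊗ₜ (a * b)) = twistedMul θ (θ (x ⊗ₜ a)) (b ⊗ₜ 1))
    (x y z : A ⊗[k] R) :
    twistedMul θ (twistedMul θ x y) z = twistedMul θ x (twistedMul θ y z) := by
  have e₁ : ∀ (a : A) (s : R) (z w : A ⊗[k] R),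
      twistedMul θ (TensorProduct.map (LinearMap.mulLeft k a) LinearMap.id z)
        (TensorProduct.map LinearMap.id (LinearMap.mulRight k s) w) =
      TensorProduct.map (LinearMap.mulLeft k a) (LinearMap.mulRight k s) (twistedMul θ z w) := by
    intro a s z w
    induction z with
    | zero => simp
    | add x y hx hy => simp only [map_add, LinearMap.add_apply, hx, hy]
    | tmul b x =>
      induction w with
      | zero => simp
      | add x y hx hy => simp only [map_add, hx, hy]
      | tmul c y =>
        simp only [TensorProduct.map_tmul, twistedMul_tmul, LinearMap.id_apply,
          LinearMap.mulLeft_apply, LinearMap.mulRight_apply]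
        rw [LinearMap.mulLeft_mul, LinearMap.mulRight_mul, TensorProduct.map_comp,
          LinearMap.comp_apply]
  have split : ∀ (a : A) (s : R) (w : A ⊗[k] R),
      TensorProduct.map (LinearMap.mulLeft k a) (LinearMap.mulRight k s) w =
      TensorProduct.map (LinearMap.mulLeft k a) LinearMap.id
        (TensorProduct.map LinearMap.id (LinearMap.mulRight k s) w) := by
    intro a s w
    rw [← LinearMap.comp_apply, ← TensorProduct.map_comp]; rfl
  have split' : ∀ (a : A) (s : R) (w : A ⊗[k] R),
      TensorProduct.map (LinearMap.mulLeft k a) (LinearMap.mulRight k s) w =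
      TensorProduct.map LinearMap.id (LinearMap.mulRight k s)
        (TensorProduct.map (LinearMap.mulLeft k a) LinearMap.id w) := by
    intro a s w
    rw [← LinearMap.comp_apply, ← TensorProduct.map_comp]; rfl
  have idid : ∀ w : A ⊗[k] R,
      TensorProduct.map (LinearMap.mulLeft k (1 : A)) (LinearMap.mulRight k (1 : R)) w = w := by
    intro w; simp
  have f₁ : ∀ (s : R) (z : A ⊗[k] R) (c : A),
      twistedMul θ (TensorProduct.map LinearMap.id (LinearMap.mulRight k s) z) (c ⊗ₜ 1) =
        twistedMul θ z (θ (s ⊗ₜ c)) := by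
    intro s z c
    induction z with
    | zero => simp
    | add x y hx hy => simp only [map_add, LinearMap.add_apply, hx, hy]
    | tmul b x =>
      have := e₁ b 1 (1 ⊗ₜ x) (θ (s ⊗ₜ c))
      simp only [TensorProduct.map_tmul, LinearMap.mulLeft_apply, mul_one, LinearMap.id_apply,
        LinearMap.mulRight_one, TensorProduct.map_id] at this
      rw [this, TensorProduct.map_tmul, LinearMap.id_apply, LinearMap.mulRight_apply,
        twistedMul_tmul, h₁, LinearMap.mulRight_one]
  have f₂ : ∀ (x : R) (b : A) (w : A ⊗[k] R),
      twistedMul θ (1 ⊗ₜ x) (TensorProduct.map (LinearMap.mulLeft k b) LinearMap.id w) =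
        twistedMul θ (θ (x ⊗ₜ b)) w := by
    intro x b w
    induction w with
    | zero => simp
    | add x y hx hy => simp only [map_add, hx, hy]
    | tmul c y =>
      have := e₁ 1 y (θ (x ⊗ₜ b)) (c ⊗ₜ 1)
      simp only [TensorProduct.map_tmul, LinearMap.mulRight_apply, one_mul, LinearMap.id_apply,
        LinearMap.mulLeft_one, TensorProduct.map_id] at this
      rw [this, TensorProduct.map_tmul, LinearMap.id_apply, LinearMap.mulLeft_apply,
        twistedMul_tmul, h₂, LinearMap.mulLeft_one]
  induction x with
  | zero => simp
  | add x y hx hy => simp only [map_add, LinearMap.add_apply, hx, hy]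
  | tmul a x =>
  induction y with
  | zero => simp
  | add x y hx hy => simp only [map_add, LinearMap.add_apply, hx, hy]
  | tmul b y =>
  induction z with
  | zero => simp
  | add x y hx hy => simp only [map_add, hx, hy]
  | tmul c z =>
    have hc : c ⊗ₜ[k] z = TensorProduct.map LinearMap.id (LinearMap.mulRight k z) (c ⊗ₜ 1) := by
      simp
    have ha : a ⊗ₜ[k] x = TensorProduct.map (LinearMap.mulLeft k a) LinearMap.id (1 ⊗ₜ x) := by
      simp
    rw [twistedMul_tmul θ a b, twistedMul_tmul θ b c, hc, split, e₁, f₁, split' b, ha, e₁, f₂]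

end Twisting

section Coalg

variable {k : Type*} [Field k] {C P Q : Type*} [AddCommGroup C] [Module k C] [Coalgebra k C]
  [AddCommGroup P] [Module k P] [AddCommGroup Q] [Module k Q]

/-- `c₍₁₎ ⊗ c₍₂₎ ⊗ c₍₃₎ ⊗ c₍₄₎` computed in two ways. -/
theorem comul_four (c : C) :
    TensorProduct.map Coalgebra.comul Coalgebra.comul (Coalgebra.comul (R := k) c) =
      (TensorProduct.assoc k C C (C ⊗[k] C)).symm
        ((TensorProduct.assoc k C C C).toLinearMap.lTensor C
          ((Coalgebra.comul.rTensor C).lTensor C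
            (Coalgebra.comul.lTensor C (Coalgebra.comul (R := k) c)))) := by
  have a1 : ∀ D : C ⊗[k] C,
      TensorProduct.assoc k C C (C ⊗[k] C)
        (TensorProduct.map Coalgebra.comul Coalgebra.comul D) =
      (Coalgebra.comul.lTensor C).lTensor C
        (TensorProduct.assoc k C C C (Coalgebra.comul.rTensor C D)) := by
    intro D
    induction D with
    | zero => simp
    | add a b ha hb => simp only [map_add, ha, hb]
    | tmul p q =>
      rw [TensorProduct.map_tmul, LinearMap.rTensor_tmul]
      induction Coalgebra.comul (R := k) p with
      | zero => simp
      | add a b ha hb => simp only [map_add, TensorProduct.add_tmul, ha, hb]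
      | tmul r s => simp
  have a2 : ∀ D : C ⊗[k] C,
      (Coalgebra.comul.lTensor C).lTensor C (Coalgebra.comul.lTensor C D) =
      (TensorProduct.assoc k C C C).toLinearMap.lTensor C
        ((Coalgebra.comul.rTensor C).lTensor C (Coalgebra.comul.lTensor C D)) := by
    intro D
    induction D with
    | zero => simp
    | add a b ha hb => simp only [map_add, ha, hb]
    | tmul p q =>
      simp only [LinearMap.lTensor_tmul]
      congr 1
      exact (Coalgebra.coassoc_apply q).symm
  rw [← a2, LinearEquiv.eq_symm_apply, a1, Coalgebra.coassoc_apply]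

theorem comul_swap (f : C →ₗ[k] P) (g : C →ₗ[k] Q)
    (h : TensorProduct.map g f ∘ₗ Coalgebra.comul =
      (TensorProduct.comm k P Q).toLinearMap ∘ₗ TensorProduct.map f g ∘ₗ Coalgebra.comul) (c : C) :
    TensorProduct.map (TensorProduct.map f g) (TensorProduct.map f g)
      (TensorProduct.map Coalgebra.comul Coalgebra.comul (Coalgebra.comul (R := k) c)) =
    TensorProduct.AlgebraTensorModule.tensorTensorTensorComm k k k k P P Q Q
      (TensorProduct.map (TensorProduct.map f f) (TensorProduct.map g g)
        (TensorProduct.map Coalgebra.comul Coalgebra.comul (Coalgebra.comul (R := k) c))) := by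
  let G : P ⊗[k] ((Q ⊗[k] P) ⊗[k] Q) →ₗ[k] (P ⊗[k] Q) ⊗[k] (P ⊗[k] Q) :=
    (TensorProduct.assoc k P Q (P ⊗[k] Q)).symm.toLinearMap ∘ₗ
      (TensorProduct.assoc k Q P Q).toLinearMap.lTensor P
  rw [comul_four]
  generalize Coalgebra.comul.lTensor C (Coalgebra.comul (R := k) c) = D
  trans G (TensorProduct.map f (TensorProduct.map
    (TensorProduct.map g f ∘ₗ Coalgebra.comul) g) D)
  · induction D with
    | zero => simp
    | add a b ha hb => simp only [map_add, ha, hb]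
    | tmul p D =>
      induction D with
      | zero => simp
      | add a b ha hb => simp only [map_add, TensorProduct.tmul_add, ha, hb]
      | tmul q s =>
        simp only [LinearMap.lTensor_tmul, LinearMap.rTensor_tmul, TensorProduct.map_tmul,
          LinearMap.comp_apply]
        induction Coalgebra.comul (R := k) q with
        | zero => simp
        | add a b ha hb =>
          simp only [map_add, TensorProduct.tmul_add, TensorProduct.add_tmul, ha, hb]
        | tmul q q' => simp [G]
  · rw [h]
    induction D with
    | zero => simp
    | add a b ha hb => simp only [map_add, ha, hb]
    | tmul p D =>
      induction D with
      | zero => simp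
      | add a b ha hb => simp only [map_add, TensorProduct.tmul_add, ha, hb]
      | tmul q s =>
        simp only [LinearMap.lTensor_tmul, LinearMap.rTensor_tmul, TensorProduct.map_tmul,
          LinearMap.comp_apply]
        induction Coalgebra.comul (R := k) q with
        | zero => simp
        | add a b ha hb =>
          simp only [map_add, TensorProduct.tmul_add, TensorProduct.add_tmul, ha, hb]
        | tmul q q' => simp [G]

/-- The coalgebra morphism `c ↦ f(c₍₁₎) ⊗ g(c₍₂₎)` for coalgebra morphisms `f`, `g` with
`g(c₍₁₎) ⊗ f(c₍₂₎) = g(c₍₂₎) ⊗ f(c₍₁₎)`. -/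
def convHom [Coalgebra k P] [Coalgebra k Q] (f : C →ₗc[k] P) (g : C →ₗc[k] Q)
    (h : TensorProduct.map g.toLinearMap f.toLinearMap ∘ₗ Coalgebra.comul =
      (TensorProduct.comm k P Q).toLinearMap ∘ₗ
        TensorProduct.map f.toLinearMap g.toLinearMap ∘ₗ Coalgebra.comul) :
    C →ₗc[k] P ⊗[k] Q where
  toLinearMap := TensorProduct.map f.toLinearMap g.toLinearMap ∘ₗ Coalgebra.comul
  counit_comp := by
    have h : ∀ D : C ⊗[k] C, Coalgebra.counit (R := k)
        (TensorProduct.map f.toLinearMap g.toLinearMap D) =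
        Coalgebra.counit (R := k) (TensorProduct.lid k _ (Coalgebra.counit.rTensor _ D)) := by
      intro D
      induction D with
      | zero => simp
      | add a b ha hb => simp only [map_add, ha, hb]
      | tmul p q =>
        have h1 : Coalgebra.counit (R := k) (f p) = Coalgebra.counit p :=
          CoalgHomClass.counit_comp_apply f p
        have h2 : Coalgebra.counit (R := k) (g q) = Coalgebra.counit q :=
          CoalgHomClass.counit_comp_apply g q
        have h3 : TensorProduct.map f.toLinearMap g.toLinearMap (p ⊗ₜ[k] q) = f p ⊗ₜ g q := rfl
        rw [h3, TensorProduct.counit_tmul, h1, h2, LinearMap.rTensor_tmul, TensorProduct.lid_tmul,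
          map_smul, smul_eq_mul, smul_eq_mul, mul_comm]
    refine LinearMap.ext fun c => ?_
    refine (h (Coalgebra.comul c)).trans ?_
    rw [Coalgebra.rTensor_counit_comul, TensorProduct.lid_tmul, one_smul]
  map_comp_comul := by
    refine LinearMap.ext fun c => ?_
    have hf : TensorProduct.map f.toLinearMap f.toLinearMap ∘ₗ Coalgebra.comul =
      Coalgebra.comul ∘ₗ f.toLinearMap := f.map_comp_comul
    have hg : TensorProduct.map g.toLinearMap g.toLinearMap ∘ₗ Coalgebra.comul =
      Coalgebra.comul ∘ₗ g.toLinearMap := g.map_comp_comul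
    have e : ∀ D : C ⊗[k] C,
        TensorProduct.map (TensorProduct.map f.toLinearMap f.toLinearMap)
          (TensorProduct.map g.toLinearMap g.toLinearMap)
          (TensorProduct.map Coalgebra.comul Coalgebra.comul D) =
        TensorProduct.map Coalgebra.comul Coalgebra.comul
          (TensorProduct.map f.toLinearMap g.toLinearMap D) := by
      intro D
      rw [← LinearMap.comp_apply, ← TensorProduct.map_comp, hf, hg, TensorProduct.map_comp,
        LinearMap.comp_apply]
    have key := comul_swap f.toLinearMap g.toLinearMap h c
    rw [e, ← LinearMap.comp_apply (TensorProduct.map _ _) (TensorProduct.map _ _),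
      ← TensorProduct.map_comp] at key
    exact key

end Coalg

/-! ### Matched pairs of Hopf algebras and the bicrossed product -/

/-- For maps `▷ : U ⊗ H → H` and `◁ : U ⊗ H → U`, the map
`ω : U ⊗ H → H ⊗ U`, `x ⊗ a ↦ (x₍₁₎ ▷ a₍₁₎) ⊗ (x₍₂₎ ◁ a₍₂₎)`. -/
def omegaMap {k : Type u} [Field k] {H : Type v} {U : Type w} [Ring H] [HopfAlgebra k H]
    [Ring U] [HopfAlgebra k U] (lact : U ⊗[k] H →ₗ[k] H) (ract : U ⊗[k] H →ₗ[k] U) :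
    U ⊗[k] H →ₗ[k] H ⊗[k] U :=
  TensorProduct.map lact ract ∘ₗ Coalgebra.comul

/-- A matched pair of Hopf algebras `(H, U, ▷, ◁)`: coalgebra maps `▷ : U ⊗ H → H` and
`◁ : U ⊗ H → U` such that `(H, ▷)` is a left `U`-module coalgebra and `(U, ◁)` is a right
`H`-module coalgebra, with the usual compatibilities. Here `x ▷ a = lact (x ⊗ₜ a)` and
`x ◁ a = ract (x ⊗ₜ a)`. -/
structure MatchedPair (k : Type u) [Field k] (H : Type v) (U : Type w)
    [Ring H] [HopfAlgebra k H] [Ring U] [HopfAlgebra k U] where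
  /-- the left action `▷` of `U` on `H` -/
  lact : U ⊗[k] H →ₗc[k] H
  /-- the right action `◁` of `H` on `U` -/
  ract : U ⊗[k] H →ₗc[k] U
  /-- `1 ▷ a = a` -/
  one_lact : ∀ a : H, lact (1 ⊗ₜ a) = a
  /-- `(x y) ▷ a = x ▷ (y ▷ a)` -/
  mul_lact : ∀ (x y : U) (a : H), lact ((x * y) ⊗ₜ a) = lact (x ⊗ₜ lact (y ⊗ₜ a))
  /-- `x ◁ 1 = x` -/
  ract_one : ∀ x : U, ract (x ⊗ₜ 1) = x
  /-- `x ◁ (a b) = (x ◁ a) ◁ b` -/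
  ract_mul : ∀ (x : U) (a b : H), ract (x ⊗ₜ (a * b)) = ract (ract (x ⊗ₜ a) ⊗ₜ b)
  /-- `x ▷ 1 = ε(x) 1` -/
  lact_one : ∀ x : U, lact (x ⊗ₜ 1) = algebraMap k H (Coalgebra.counit x)
  /-- `1 ◁ a = ε(a) 1` -/
  one_ract : ∀ a : H, ract (1 ⊗ₜ a) = algebraMap k U (Coalgebra.counit a)
  /-- `x ▷ (a b) = (x₍₁₎ ▷ a₍₁₎) ((x₍₂₎ ◁ a₍₂₎) ▷ b)` -/
  lact_mul : ∀ (x : U) (a b : H), lact (x ⊗ₜ (a * b)) =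
    LinearMap.mul' k H
      ((lact.toLinearMap ∘ₗ (TensorProduct.mk k U H).flip b).lTensor H
        (omegaMap lact.toLinearMap ract.toLinearMap (x ⊗ₜ a)))
  /-- `(y x) ◁ a = (y ◁ (x₍₁₎ ▷ a₍₁₎)) (x₍₂₎ ◁ a₍₂₎)` -/
  mul_ract : ∀ (y x : U) (a : H), ract ((y * x) ⊗ₜ a) =
    LinearMap.mul' k U
      ((ract.toLinearMap ∘ₗ TensorProduct.mk k U H y).rTensor U
        (omegaMap lact.toLinearMap ract.toLinearMap (x ⊗ₜ a)))
  /-- `(y₍₁₎ ◁ a₍₁₎) ⊗ (y₍₂₎ ▷ a₍₂₎) = (y₍₂₎ ◁ a₍₂₎) ⊗ (y₍₁₎ ▷ a₍₁₎)` -/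
  ract_lact_comm : ∀ (y : U) (a : H),
    TensorProduct.map ract.toLinearMap lact.toLinearMap (Coalgebra.comul (y ⊗ₜ[k] a)) =
      TensorProduct.comm k H U
        (TensorProduct.map lact.toLinearMap ract.toLinearMap (Coalgebra.comul (y ⊗ₜ[k] a)))

namespace MatchedPair

variable {k : Type u} [Field k] {H : Type v} {U : Type w} [Ring H] [HopfAlgebra k H]
    [Ring U] [HopfAlgebra k U] (M : MatchedPair k H U)

/-- The map `ω : U ⊗ H → H ⊗ U`, `x ⊗ a ↦ (x₍₁₎ ▷ a₍₁₎) ⊗ (x₍₂₎ ◁ a₍₂₎)`. -/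
def omega : U ⊗[k] H →ₗ[k] H ⊗[k] U := omegaMap M.lact.toLinearMap M.ract.toLinearMap

theorem omega_apply (c : U ⊗[k] H) :
    M.omega c = TensorProduct.map M.lact.toLinearMap M.ract.toLinearMap (Coalgebra.comul c) := rfl

theorem comul_lact (c : U ⊗[k] H) : Coalgebra.comul (R := k) (M.lact c) =
    TensorProduct.map M.lact.toLinearMap M.lact.toLinearMap (Coalgebra.comul c) :=
  (CoalgHomClass.map_comp_comul_apply M.lact c).symm

theorem comul_ract (c : U ⊗[k] H) : Coalgebra.comul (R := k) (M.ract c) =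
    TensorProduct.map M.ract.toLinearMap M.ract.toLinearMap (Coalgebra.comul c) :=
  (CoalgHomClass.map_comp_comul_apply M.ract c).symm

theorem lact_mul_left (x : U) (c : U ⊗[k] H) :
    M.lact ((x ⊗ₜ 1) * c) = M.lact (x ⊗ₜ M.lact c) := by
  induction c with
  | zero => simp
  | add a b ha hb => simp only [mul_add, map_add, TensorProduct.tmul_add, ha, hb]
  | tmul y a => simp [M.mul_lact]

theorem ract_mul_left (x : U) (c : U ⊗[k] H) :
    M.ract ((x ⊗ₜ 1) * c) = LinearMap.mul' k U
      ((M.ract.toLinearMap ∘ₗ TensorProduct.mk k U H x).rTensor U (M.omega c)) := by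
  induction c with
  | zero => simp
  | add a b ha hb => simp only [mul_add, map_add, ha, hb]
  | tmul y a => simp only [Algebra.TensorProduct.tmul_mul_tmul, one_mul, M.mul_ract]; rfl

theorem lact_mul_right (b : H) (c : U ⊗[k] H) :
    M.lact (c * (1 ⊗ₜ b)) = LinearMap.mul' k H
      ((M.lact.toLinearMap ∘ₗ (TensorProduct.mk k U H).flip b).lTensor H (M.omega c)) := by
  induction c with
  | zero => simp
  | add a b ha hb => simp only [add_mul, map_add, ha, hb]
  | tmul y a => simp only [Algebra.TensorProduct.tmul_mul_tmul, mul_one, M.lact_mul]; rfl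

theorem ract_mul_right (b : H) (c : U ⊗[k] H) :
    M.ract (c * (1 ⊗ₜ b)) = M.ract (M.ract c ⊗ₜ b) := by
  induction c with
  | zero => simp
  | add a b ha hb => simp only [add_mul, map_add, TensorProduct.add_tmul, ha, hb]
  | tmul y a => simp [M.ract_mul]

theorem comul_tmul_one (x : U) : Coalgebra.comul (R := k) (x ⊗ₜ[k] (1 : H)) =
    ∑ i ∈ (Coalgebra.Repr.arbitrary k x).index,
      ((Coalgebra.Repr.arbitrary k x).left i ⊗ₜ[k] (1 : H)) ⊗ₜ[k]
        ((Coalgebra.Repr.arbitrary k x).right i ⊗ₜ[k] (1 : H)) := by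
  rw [TensorProduct.comul_tmul, ← (Coalgebra.Repr.arbitrary k x).eq, Bialgebra.comul_one,
    Algebra.TensorProduct.one_def, TensorProduct.sum_tmul, map_sum]
  rfl

theorem comul_one_tmul (b : H) : Coalgebra.comul (R := k) ((1 : U) ⊗ₜ[k] b) =
    ∑ i ∈ (Coalgebra.Repr.arbitrary k b).index,
      ((1 : U) ⊗ₜ[k] (Coalgebra.Repr.arbitrary k b).left i) ⊗ₜ[k]
        ((1 : U) ⊗ₜ[k] (Coalgebra.Repr.arbitrary k b).right i) := by
  rw [TensorProduct.comul_tmul, ← (Coalgebra.Repr.arbitrary k b).eq, Bialgebra.comul_one,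
    Algebra.TensorProduct.one_def, TensorProduct.tmul_sum, map_sum]
  rfl

theorem omega_mul_left (x : U) (c : U ⊗[k] H) :
    M.omega ((x ⊗ₜ 1) * c) = twistedMul M.omega (1 ⊗ₜ x) (M.omega c) := by
  let Ψ : U → U → (U ⊗[k] H) ⊗[k] ((U ⊗[k] H) ⊗[k] (U ⊗[k] H)) →ₗ[k] H ⊗[k] U := fun s t =>
    TensorProduct.map (M.lact.toLinearMap ∘ₗ TensorProduct.mk k U H s ∘ₗ M.lact.toLinearMap)
      (LinearMap.mul' k U ∘ₗ TensorProduct.map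
        (M.ract.toLinearMap ∘ₗ TensorProduct.mk k U H t ∘ₗ M.lact.toLinearMap)
        M.ract.toLinearMap)
  have hl : ∀ (s t : U) (D : (U ⊗[k] H) ⊗[k] (U ⊗[k] H)),
      TensorProduct.map M.lact.toLinearMap M.ract.toLinearMap
        (((s ⊗ₜ 1) ⊗ₜ (t ⊗ₜ 1)) * D) = Ψ s t (Coalgebra.comul.lTensor _ D) := by
    intro s t D
    induction D with
    | zero => simp
    | add a b ha hb => simp only [mul_add, map_add, ha, hb]
    | tmul p q =>
      have h1 : M.ract ((t ⊗ₜ 1) * q) = (LinearMap.mul' k U ∘ₗ TensorProduct.map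
        (M.ract.toLinearMap ∘ₗ TensorProduct.mk k U H t ∘ₗ M.lact.toLinearMap)
        M.ract.toLinearMap) (Coalgebra.comul q) := by
        rw [ract_mul_left, omega_apply, ← LinearMap.comp_apply (LinearMap.rTensor _ _),
          LinearMap.rTensor_comp_map]
        rfl
      simp only [Algebra.TensorProduct.tmul_mul_tmul, TensorProduct.map_tmul,
        LinearMap.lTensor_tmul, Ψ]
      exact congrArg₂ _ (M.lact_mul_left s p) h1
  have hr : ∀ D : (U ⊗[k] H) ⊗[k] (U ⊗[k] H),
      twistedMul M.omega (1 ⊗ₜ x) (TensorProduct.map M.lact.toLinearMap M.ract.toLinearMap D) =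
      ∑ i ∈ (Coalgebra.Repr.arbitrary k x).index,
        Ψ ((Coalgebra.Repr.arbitrary k x).left i) ((Coalgebra.Repr.arbitrary k x).right i)
          (TensorProduct.assoc k _ _ _ (Coalgebra.comul.rTensor _ D)) := by
    intro D
    induction D with
    | zero => simp
    | add a b ha hb => simp only [map_add, ha, hb, Finset.sum_add_distrib]
    | tmul p r =>
      have h2 : M.omega (x ⊗ₜ M.lact p) = TensorProduct.map M.lact.toLinearMap M.ract.toLinearMap
          (TensorProduct.AlgebraTensorModule.tensorTensorTensorComm k k k k U U H H
            (Coalgebra.comul x ⊗ₜ TensorProduct.map M.lact.toLinearMap M.lact.toLinearMap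
              (Coalgebra.comul p))) := by
        rw [← comul_lact]; rfl
      have h3 : TensorProduct.map M.lact.toLinearMap M.ract.toLinearMap (p ⊗ₜ[k] r) =
        M.lact p ⊗ₜ M.ract r := rfl
      rw [h3, twistedMul_tmul, h2, LinearMap.rTensor_tmul, ← (Coalgebra.Repr.arbitrary k x).eq]
      simp only [TensorProduct.sum_tmul, map_sum]
      refine Finset.sum_congr rfl fun i _ => ?_
      induction Coalgebra.comul (R := k) p with
      | zero => simp
      | add a b ha hb => simp only [map_add, TensorProduct.tmul_add, TensorProduct.add_tmul, ha, hb]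
      | tmul q q' => simp [Ψ]
  rw [omega_apply, omega_apply, Bialgebra.comul_mul, comul_tmul_one, Finset.sum_mul, map_sum, hr,
    Coalgebra.coassoc_apply]
  exact Finset.sum_congr rfl fun i _ => hl _ _ _

theorem omega_mul_right (b : H) (c : U ⊗[k] H) :
    M.omega (c * (1 ⊗ₜ b)) = twistedMul M.omega (M.omega c) (b ⊗ₜ 1) := by
  let Ψ : H → H → (U ⊗[k] H) ⊗[k] ((U ⊗[k] H) ⊗[k] (U ⊗[k] H)) →ₗ[k] H ⊗[k] U := fun s t =>
    TensorProduct.map (LinearMap.mul' k H) LinearMap.id ∘ₗ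
    (TensorProduct.assoc k H H U).symm.toLinearMap ∘ₗ
    TensorProduct.map M.lact.toLinearMap (TensorProduct.map
      (M.lact.toLinearMap ∘ₗ (TensorProduct.mk k U H).flip s ∘ₗ M.ract.toLinearMap)
      (M.ract.toLinearMap ∘ₗ (TensorProduct.mk k U H).flip t ∘ₗ M.ract.toLinearMap))
  have hl : ∀ (s t : H) (D : (U ⊗[k] H) ⊗[k] (U ⊗[k] H)),
      TensorProduct.map M.lact.toLinearMap M.ract.toLinearMap
        (D * ((1 ⊗ₜ s) ⊗ₜ (1 ⊗ₜ t))) =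
      Ψ s t (TensorProduct.assoc k _ _ _ (Coalgebra.comul.rTensor _ D)) := by
    intro s t D
    induction D with
    | zero => simp
    | add a b ha hb => simp only [add_mul, map_add, ha, hb]
    | tmul p q =>
      have h1 : M.lact (p * (1 ⊗ₜ s)) = (LinearMap.mul' k H ∘ₗ TensorProduct.map
        M.lact.toLinearMap
        (M.lact.toLinearMap ∘ₗ (TensorProduct.mk k U H).flip s ∘ₗ M.ract.toLinearMap))
          (Coalgebra.comul p) := by
        rw [lact_mul_right, omega_apply, ← LinearMap.comp_apply (LinearMap.lTensor _ _),
          LinearMap.lTensor_comp_map]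
        rfl
      have h3 : TensorProduct.map M.lact.toLinearMap M.ract.toLinearMap
          ((p ⊗ₜ[k] q) * ((1 ⊗ₜ s) ⊗ₜ (1 ⊗ₜ t))) =
        M.lact (p * (1 ⊗ₜ s)) ⊗ₜ M.ract (q * (1 ⊗ₜ t)) := by
        rw [Algebra.TensorProduct.tmul_mul_tmul]; rfl
      rw [h3, h1, ract_mul_right, LinearMap.rTensor_tmul]
      induction Coalgebra.comul (R := k) p with
      | zero => simp
      | add a b ha hb => simp only [map_add, TensorProduct.add_tmul, ha, hb]
      | tmul u u' => simp [Ψ]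
  have hr : ∀ D : (U ⊗[k] H) ⊗[k] (U ⊗[k] H),
      twistedMul M.omega (TensorProduct.map M.lact.toLinearMap M.ract.toLinearMap D) (b ⊗ₜ 1) =
      ∑ i ∈ (Coalgebra.Repr.arbitrary k b).index,
        Ψ ((Coalgebra.Repr.arbitrary k b).left i) ((Coalgebra.Repr.arbitrary k b).right i)
          (Coalgebra.comul.lTensor _ D) := by
    intro D
    induction D with
    | zero => simp
    | add a b ha hb => simp only [map_add, LinearMap.add_apply, ha, hb, Finset.sum_add_distrib]
    | tmul p r =>
      have h2 : M.omega (M.ract r ⊗ₜ b) = TensorProduct.map M.lact.toLinearMap M.ract.toLinearMap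
          (TensorProduct.AlgebraTensorModule.tensorTensorTensorComm k k k k U U H H
            (TensorProduct.map M.ract.toLinearMap M.ract.toLinearMap
              (Coalgebra.comul r) ⊗ₜ Coalgebra.comul b)) := by
        rw [← comul_ract]; rfl
      have h3 : TensorProduct.map M.lact.toLinearMap M.ract.toLinearMap (p ⊗ₜ[k] r) =
        M.lact p ⊗ₜ M.ract r := rfl
      rw [h3, twistedMul_tmul, h2, LinearMap.lTensor_tmul, ← (Coalgebra.Repr.arbitrary k b).eq]
      simp only [TensorProduct.tmul_sum, map_sum]
      refine Finset.sum_congr rfl fun i _ => ?_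
      induction Coalgebra.comul (R := k) r with
      | zero => simp
      | add a b ha hb => simp only [map_add, TensorProduct.tmul_add, TensorProduct.add_tmul, ha, hb]
      | tmul q q' => simp [Ψ]
  rw [omega_apply, omega_apply, Bialgebra.comul_mul, comul_one_tmul, Finset.mul_sum, map_sum, hr,
    ← Coalgebra.coassoc_apply]
  exact Finset.sum_congr rfl fun i _ => hl _ _ _

theorem omega_one_tmul (a : H) : M.omega (1 ⊗ₜ a) = a ⊗ₜ 1 := by
  rw [omega_apply, comul_one_tmul, map_sum]
  have h : ∀ s t : H, TensorProduct.map M.lact.toLinearMap M.ract.toLinearMap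
      (((1 : U) ⊗ₜ[k] s) ⊗ₜ[k] ((1 : U) ⊗ₜ[k] t)) =
      (Coalgebra.counit (R := k) t • s) ⊗ₜ (1 : U) := by
    intro s t
    have h3 : TensorProduct.map M.lact.toLinearMap M.ract.toLinearMap
      (((1 : U) ⊗ₜ[k] s) ⊗ₜ[k] ((1 : U) ⊗ₜ[k] t)) =
      M.lact ((1 : U) ⊗ₜ[k] s) ⊗ₜ M.ract ((1 : U) ⊗ₜ[k] t) := rfl
    rw [h3, M.one_lact, M.one_ract, Algebra.algebraMap_eq_smul_one, TensorProduct.smul_tmul]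
  simp only [h]
  rw [← TensorProduct.sum_tmul]
  congr 1
  have := Coalgebra.lTensor_counit_comul (R := k) a
  rw [← (Coalgebra.Repr.arbitrary k a).eq, map_sum] at this
  have h' := congrArg (TensorProduct.rid k H) this
  simpa only [map_sum, LinearMap.lTensor_tmul, TensorProduct.rid_tmul, one_smul] using h'

theorem omega_tmul_one (x : U) : M.omega (x ⊗ₜ 1) = 1 ⊗ₜ x := by
  rw [omega_apply, comul_tmul_one, map_sum]
  have h : ∀ s t : U, TensorProduct.map M.lact.toLinearMap M.ract.toLinearMap
      ((s ⊗ₜ[k] (1 : H)) ⊗ₜ[k] (t ⊗ₜ[k] (1 : H))) =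
      (1 : H) ⊗ₜ (Coalgebra.counit (R := k) s • t) := by
    intro s t
    have h3 : TensorProduct.map M.lact.toLinearMap M.ract.toLinearMap
      ((s ⊗ₜ[k] (1 : H)) ⊗ₜ[k] (t ⊗ₜ[k] (1 : H))) =
      M.lact (s ⊗ₜ[k] (1 : H)) ⊗ₜ M.ract (t ⊗ₜ[k] (1 : H)) := rfl
    rw [h3, M.lact_one, M.ract_one, Algebra.algebraMap_eq_smul_one, TensorProduct.smul_tmul]
  simp only [h]
  rw [← TensorProduct.tmul_sum]
  congr 1
  have := Coalgebra.rTensor_counit_comul (R := k) x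
  rw [← (Coalgebra.Repr.arbitrary k x).eq, map_sum] at this
  have h' := congrArg (TensorProduct.lid k U) this
  simpa only [map_sum, LinearMap.rTensor_tmul, TensorProduct.lid_tmul, one_smul] using h'

/-- The twisting map `ω` of a matched pair. -/
def twisting : TwistingMap k H U where
  toLinearMap := M.omega
  mul_assoc := twistedMul_assoc_of M.omega
    (fun x y a => by simpa using M.omega_mul_left x (y ⊗ₜ a))
    (fun x a b => by simpa using M.omega_mul_right b (x ⊗ₜ a))
  one_mul z := by
    induction z with
    | zero => simp
    | add a b ha hb => simp only [map_add, ha, hb]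
    | tmul a x => rw [twistedMul_tmul, omega_one_tmul]; simp
  mul_one z := by
    induction z with
    | zero => simp
    | add a b ha hb => simp only [map_add, LinearMap.add_apply, ha, hb]
    | tmul a x => rw [twistedMul_tmul, omega_tmul_one]; simp

/-- `ω` is a morphism of coalgebras. -/
def omegaHom : U ⊗[k] H →ₗc[k] H ⊗[k] U :=
  convHom M.lact M.ract (TensorProduct.ext' fun y a => M.ract_lact_comm y a)

/-- The multiplication of the bicrossed product is a morphism of coalgebras. -/
def mulHom : (H ⊗[k] U) ⊗[k] (H ⊗[k] U) →ₗc[k] H ⊗[k] U :=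
  (Coalgebra.TensorProduct.map (Bialgebra.mulCoalgHom k H) (Bialgebra.mulCoalgHom k U)).comp <|
    (Coalgebra.TensorProduct.assoc k k H H (U ⊗[k] U)).symm.toCoalgHom.comp <|
    (CoalgHom.lTensor H (Coalgebra.TensorProduct.assoc k k H U U).toCoalgHom).comp <|
    (CoalgHom.lTensor H (CoalgHom.rTensor U M.omegaHom)).comp <|
    (CoalgHom.lTensor H (Coalgebra.TensorProduct.assoc k k U H U).symm.toCoalgHom).comp
    (Coalgebra.TensorProduct.assoc k k H U (H ⊗[k] U)).toCoalgHom

theorem mulHom_tmul (x y : H ⊗[k] U) : M.mulHom (x ⊗ₜ y) = twistedMul M.omega x y := rfl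

end MatchedPair

section Bicrossed

variable {k : Type u} [Field k] {H : Type v} {U : Type w} [Ring H] [HopfAlgebra k H]
    [Ring U] [HopfAlgebra k U] (M : MatchedPair k H U)

/-- The bicrossed product `H ⋈ U`: the coalgebra `H ⊗ U` with the multiplication
`(a ⋈ x)(b ⋈ y) = a (x₍₁₎ ▷ b₍₁₎) ⋈ (x₍₂₎ ◁ b₍₂₎) y`. -/
abbrev BicrossedProduct : Type (max v w) := TwistedTensor M.twisting

namespace BicrossedProduct

instance : Coalgebra k (BicrossedProduct M) := inferInstanceAs (Coalgebra k (H ⊗[k] U))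

theorem counit_of (z : H ⊗[k] U) :
    Coalgebra.counit (R := k) (TwistedTensor.of M.twisting z) = Coalgebra.counit (R := k) z := rfl

theorem comul_of (z : H ⊗[k] U) :
    Coalgebra.comul (R := k) (TwistedTensor.of M.twisting z) =
      TensorProduct.map (TwistedTensor.of M.twisting).toLinearMap
        (TwistedTensor.of M.twisting).toLinearMap (Coalgebra.comul (R := k) z) :=
  (congrFun (congrArg DFunLike.coe
    (TensorProduct.map_id (R := k) (M := H ⊗[k] U) (N := H ⊗[k] U))) _).symm

instance : Bialgebra k (BicrossedProduct M) :=
  Bialgebra.mk' k (BicrossedProduct M)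
    (by
      rw [TwistedTensor.one_eq, counit_of]
      simp)
    (by
      intro a b
      obtain ⟨a, rfl⟩ := (TwistedTensor.of M.twisting).surjective a
      obtain ⟨b, rfl⟩ := (TwistedTensor.of M.twisting).surjective b
      rw [TwistedTensor.of_mul_of, counit_of, counit_of, counit_of]
      refine (CoalgHomClass.counit_comp_apply M.mulHom (a ⊗ₜ b)).trans ?_
      rw [TensorProduct.counit_tmul, smul_eq_mul, mul_comm])
    (by
      rw [TwistedTensor.one_eq, comul_of, Algebra.TensorProduct.one_def, TensorProduct.comul_tmul]
      simp [Algebra.TensorProduct.one_def, TwistedTensor.one_eq])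
    (by
      intro a b
      obtain ⟨a, rfl⟩ := (TwistedTensor.of M.twisting).surjective a
      obtain ⟨b, rfl⟩ := (TwistedTensor.of M.twisting).surjective b
      rw [TwistedTensor.of_mul_of, comul_of, comul_of, comul_of]
      have h : Coalgebra.comul (R := k) (twistedMul M.omega a b) =
        TensorProduct.map M.mulHom.toLinearMap M.mulHom.toLinearMap
          (TensorProduct.AlgebraTensorModule.tensorTensorTensorComm k k k k _ _ _ _
            (Coalgebra.comul a ⊗ₜ Coalgebra.comul b)) :=
        (CoalgHomClass.map_comp_comul_apply M.mulHom (a ⊗ₜ b)).symm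
      refine (congrArg _ h).trans ?_
      induction Coalgebra.comul (R := k) a with
      | zero => simp
      | add x y hx hy => simp only [map_add, TensorProduct.add_tmul, add_mul, hx, hy]
      | tmul x x' =>
        induction Coalgebra.comul (R := k) b with
        | zero => simp
        | add x y hx hy => simp only [map_add, TensorProduct.tmul_add, mul_add, hx, hy]
        | tmul y y' =>
          simp only [TensorProduct.AlgebraTensorModule.tensorTensorTensorComm_tmul,
            TensorProduct.map_tmul, Algebra.TensorProduct.tmul_mul_tmul]
          rfl)

theorem of_tmul (a : H) (x : U) : TwistedTensor.of M.twisting (a ⊗ₜ x) =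
    TwistedTensor.of M.twisting (a ⊗ₜ 1) * TwistedTensor.of M.twisting (1 ⊗ₜ x) := by
  rw [TwistedTensor.of_mul_of, twistedMul_tmul]
  refine congrArg _ ?_
  rw [show M.twisting.toLinearMap (1 ⊗ₜ 1) = _ from M.omega_one_tmul 1]
  simp

theorem of_omega (a : H) (x : U) : TwistedTensor.of M.twisting (M.omega (x ⊗ₜ a)) =
    TwistedTensor.of M.twisting (1 ⊗ₜ x) * TwistedTensor.of M.twisting (a ⊗ₜ 1) := by
  rw [TwistedTensor.of_mul_of, twistedMul_tmul]
  refine congrArg _ ?_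
  simp [MatchedPair.twisting]

theorem of_mul_left (a b : H) : TwistedTensor.of M.twisting ((a * b) ⊗ₜ 1) =
    TwistedTensor.of M.twisting (a ⊗ₜ 1) * TwistedTensor.of M.twisting (b ⊗ₜ 1) := by
  rw [TwistedTensor.of_mul_of, twistedMul_tmul]
  refine congrArg _ ?_
  rw [show M.twisting.toLinearMap (1 ⊗ₜ b) = _ from M.omega_one_tmul b]
  simp

theorem of_mul_right (x y : U) : TwistedTensor.of M.twisting (1 ⊗ₜ (x * y)) =
    TwistedTensor.of M.twisting (1 ⊗ₜ x) * TwistedTensor.of M.twisting (1 ⊗ₜ y) := by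
  rw [TwistedTensor.of_mul_of, twistedMul_tmul]
  refine congrArg _ ?_
  rw [show M.twisting.toLinearMap (x ⊗ₜ 1) = _ from M.omega_tmul_one x]
  simp

/-- The antipode `a ⋈ x ↦ (1 ⋈ S(x)) (S(a) ⋈ 1) = ω(S(x) ⊗ S(a))`. -/
def antipodeMap : BicrossedProduct M →ₗ[k] BicrossedProduct M :=
  (TwistedTensor.of M.twisting).toLinearMap ∘ₗ M.omega ∘ₗ
    TensorProduct.map (HopfAlgebra.antipode k) (HopfAlgebra.antipode k) ∘ₗ
    (TensorProduct.comm k H U).toLinearMap ∘ₗ (TwistedTensor.of M.twisting).symm.toLinearMap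

theorem antipodeMap_of (a : H) (x : U) :
    antipodeMap M (TwistedTensor.of M.twisting (a ⊗ₜ x)) =
      TwistedTensor.of M.twisting (1 ⊗ₜ HopfAlgebra.antipode k x) *
        TwistedTensor.of M.twisting (HopfAlgebra.antipode k a ⊗ₜ 1) := by
  rw [← of_omega]; rfl

theorem comul_of_tmul (a : H) (x : U) :
    Coalgebra.comul (R := k) (TwistedTensor.of M.twisting (a ⊗ₜ x)) =
      ∑ j ∈ (Coalgebra.Repr.arbitrary k x).index, ∑ i ∈ (Coalgebra.Repr.arbitrary k a).index,
        TwistedTensor.of M.twisting ((Coalgebra.Repr.arbitrary k a).left i ⊗ₜ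
          (Coalgebra.Repr.arbitrary k x).left j) ⊗ₜ
        TwistedTensor.of M.twisting ((Coalgebra.Repr.arbitrary k a).right i ⊗ₜ
          (Coalgebra.Repr.arbitrary k x).right j) := by
  rw [comul_of, TensorProduct.comul_tmul, ← (Coalgebra.Repr.arbitrary k x).eq,
    ← (Coalgebra.Repr.arbitrary k a).eq]
  simp only [TensorProduct.tmul_sum, TensorProduct.sum_tmul, map_sum]
  rfl

instance : HopfAlgebra k (BicrossedProduct M) where
  antipode := antipodeMap M
  mul_antipode_rTensor_comul := by
    refine LinearMap.ext fun e => ?_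
    obtain ⟨z, rfl⟩ := (TwistedTensor.of M.twisting).surjective e
    induction z with
    | zero => simp
    | add x y hx hy => simp only [map_add, hx, hy]
    | tmul a x =>
      rw [LinearMap.comp_apply, LinearMap.comp_apply, LinearMap.comp_apply, counit_of,
        comul_of_tmul]
      simp only [map_sum, LinearMap.rTensor_tmul, LinearMap.mul'_apply, antipodeMap_of]
      have h : ∀ i j,
          TwistedTensor.of M.twisting (1 ⊗ₜ HopfAlgebra.antipode k
              ((Coalgebra.Repr.arbitrary k x).left j)) *
            TwistedTensor.of M.twisting (HopfAlgebra.antipode k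
              ((Coalgebra.Repr.arbitrary k a).left i) ⊗ₜ 1) *
            TwistedTensor.of M.twisting ((Coalgebra.Repr.arbitrary k a).right i ⊗ₜ
              (Coalgebra.Repr.arbitrary k x).right j) =
          TwistedTensor.of M.twisting (1 ⊗ₜ HopfAlgebra.antipode k
              ((Coalgebra.Repr.arbitrary k x).left j)) *
            TwistedTensor.of M.twisting ((HopfAlgebra.antipode k
              ((Coalgebra.Repr.arbitrary k a).left i) *
                (Coalgebra.Repr.arbitrary k a).right i) ⊗ₜ 1) *
            TwistedTensor.of M.twisting (1 ⊗ₜ (Coalgebra.Repr.arbitrary k x).right j) := by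
        intro i j
        rw [of_tmul M ((Coalgebra.Repr.arbitrary k a).right i), of_mul_left]
        simp only [mul_assoc]
      simp only [h]
      simp only [← Finset.sum_mul, ← Finset.mul_sum, ← map_sum, ← TensorProduct.sum_tmul,
        HopfAlgebra.sum_antipode_mul_eq_algebraMap_counit]
      have h' : TwistedTensor.of M.twisting (algebraMap k H (Coalgebra.counit a) ⊗ₜ 1) =
          algebraMap k (BicrossedProduct M) (Coalgebra.counit a) := by
        rw [Algebra.algebraMap_eq_smul_one, Algebra.algebraMap_eq_smul_one,
          ← TensorProduct.smul_tmul', map_smul]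
        rfl
      simp only [h', ← Algebra.commutes, mul_assoc, ← of_mul_right]
      simp only [← Finset.mul_sum, ← map_sum, ← TensorProduct.tmul_sum,
        HopfAlgebra.sum_antipode_mul_eq_algebraMap_counit]
      rw [Algebra.algebraMap_eq_smul_one (Coalgebra.counit x), TensorProduct.tmul_smul, map_smul,
        ← TwistedTensor.one_eq, TensorProduct.counit_tmul, Algebra.linearMap_apply, smul_eq_mul,
        mul_comm (Coalgebra.counit x), map_mul, Algebra.algebraMap_eq_smul_one (Coalgebra.counit x)]
  mul_antipode_lTensor_comul := by
    refine LinearMap.ext fun e => ?_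
    obtain ⟨z, rfl⟩ := (TwistedTensor.of M.twisting).surjective e
    induction z with
    | zero => simp
    | add x y hx hy => simp only [map_add, hx, hy]
    | tmul a x =>
      rw [LinearMap.comp_apply, LinearMap.comp_apply, LinearMap.comp_apply, counit_of,
        comul_of_tmul, Finset.sum_comm]
      simp only [map_sum, LinearMap.lTensor_tmul, LinearMap.mul'_apply, antipodeMap_of]
      have h : ∀ i j,
          TwistedTensor.of M.twisting ((Coalgebra.Repr.arbitrary k a).left i ⊗ₜ
              (Coalgebra.Repr.arbitrary k x).left j) *
            (TwistedTensor.of M.twisting (1 ⊗ₜ HopfAlgebra.antipode k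
              ((Coalgebra.Repr.arbitrary k x).right j)) *
            TwistedTensor.of M.twisting (HopfAlgebra.antipode k
              ((Coalgebra.Repr.arbitrary k a).right i) ⊗ₜ 1)) =
          TwistedTensor.of M.twisting ((Coalgebra.Repr.arbitrary k a).left i ⊗ₜ 1) *
            TwistedTensor.of M.twisting (1 ⊗ₜ ((Coalgebra.Repr.arbitrary k x).left j *
              HopfAlgebra.antipode k ((Coalgebra.Repr.arbitrary k x).right j))) *
            TwistedTensor.of M.twisting (HopfAlgebra.antipode k
              ((Coalgebra.Repr.arbitrary k a).right i) ⊗ₜ 1) := by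
        intro i j
        rw [of_tmul M ((Coalgebra.Repr.arbitrary k a).left i), of_mul_right]
        simp only [mul_assoc]
      simp only [h]
      simp only [← Finset.sum_mul, ← Finset.mul_sum, ← map_sum, ← TensorProduct.tmul_sum,
        HopfAlgebra.sum_mul_antipode_eq_algebraMap_counit]
      have h' : TwistedTensor.of M.twisting (1 ⊗ₜ algebraMap k U (Coalgebra.counit x)) =
          algebraMap k (BicrossedProduct M) (Coalgebra.counit x) := by
        rw [Algebra.algebraMap_eq_smul_one, Algebra.algebraMap_eq_smul_one,
          TensorProduct.tmul_smul, map_smul]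
        rfl
      simp only [h', ← Algebra.commutes, mul_assoc, ← of_mul_left]
      simp only [← Finset.mul_sum, ← map_sum, ← TensorProduct.sum_tmul,
        HopfAlgebra.sum_mul_antipode_eq_algebraMap_counit]
      rw [Algebra.algebraMap_eq_smul_one (Coalgebra.counit a), ← TensorProduct.smul_tmul', map_smul,
        ← TwistedTensor.one_eq, TensorProduct.counit_tmul, Algebra.linearMap_apply, smul_eq_mul,
        map_mul, Algebra.algebraMap_eq_smul_one (Coalgebra.counit a)]

end BicrossedProduct

end Bicrossed
/-! ### Comodule algebras and Hopf-Galois objects -/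

section Galois

variable {k : Type*} [Field k] {H : Type*} [Ring H] [HopfAlgebra k H]
  {A : Type*} [Ring A] [Algebra k A] {A' : Type*} [Ring A'] [Algebra k A']

/-- `ρ : A → A ⊗ H` makes the algebra `A` a right `H`-comodule algebra. -/
structure IsComoduleAlgebra (ρ : A →ₗ[k] A ⊗[k] H) : Prop where
  coassoc : (TensorProduct.assoc k A H H).toLinearMap ∘ₗ ρ.rTensor H ∘ₗ ρ =
    Coalgebra.comul.lTensor A ∘ₗ ρ
  counit : Coalgebra.counit.lTensor A ∘ₗ ρ = (TensorProduct.mk k A k).flip 1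
  map_one : ρ 1 = 1
  map_mul : ∀ a b : A, ρ (a * b) = ρ a * ρ b

/-- The coinvariants `{a ∈ A | ρ(a) = a ⊗ 1}`. -/
def coinvariants (ρ : A →ₗ[k] A ⊗[k] H) : Submodule k A :=
  LinearMap.eqLocus ρ ((TensorProduct.mk k A H).flip 1)

/-- The Galois map `A ⊗ A → A ⊗ H`, `a ⊗ b ↦ a b₍₀₎ ⊗ b₍₁₎`. -/
def galoisMap (ρ : A →ₗ[k] A ⊗[k] H) : A ⊗[k] A →ₗ[k] A ⊗[k] H :=
  (LinearMap.mul' k A).rTensor H ∘ₗ (TensorProduct.assoc k A A H).symm.toLinearMap ∘ₗ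
    ρ.lTensor A

/-- `(A, ρ)` is a right `H`-Galois object: a right `H`-comodule algebra with trivial coinvariants
(equal to `k`, so that in particular `A ≠ 0`) and bijective Galois map. -/
structure IsGaloisObject (ρ : A →ₗ[k] A ⊗[k] H) : Prop extends IsComoduleAlgebra ρ where
  nontrivial : Nontrivial A
  coinvariants_eq : coinvariants ρ = LinearMap.range (Algebra.linearMap k A)
  bijective : Function.Bijective (galoisMap ρ)

/-- `f : A → A'` is a morphism of right `H`-comodules. -/
def IsColinear (ρ : A →ₗ[k] A ⊗[k] H) (ρ' : A' →ₗ[k] A' ⊗[k] H) (f : A →ₗ[k] A') : Prop :=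
  ρ' ∘ₗ f = f.rTensor H ∘ₗ ρ

end Galois

section Coaction

variable {k : Type*} [Field k] {H U : Type*} [Ring H] [HopfAlgebra k H] [Ring U] [HopfAlgebra k U]
  {A R : Type*} [Ring A] [Algebra k A] [Ring R] [Algebra k R]

/-- `A ⊗ R → A ⊗ R ⊗ H ⊗ U`, `a ⊗ r ↦ a₍₀₎ ⊗ r₍₀₎ ⊗ a₍₁₎ ⊗ r₍₁₎`. -/
def tensorCoaction (ρA : A →ₗ[k] A ⊗[k] H) (ρR : R →ₗ[k] R ⊗[k] U) :
    A ⊗[k] R →ₗ[k] (A ⊗[k] R) ⊗[k] (H ⊗[k] U) :=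
  (TensorProduct.tensorTensorTensorComm k A H R U).toLinearMap ∘ₗ TensorProduct.map ρA ρR

/-- The compatibility `ρ_{A ⊗ R} ∘ θ = (θ ⊗ ω) ∘ ρ_{R ⊗ A}` of a twisting map with the
coactions. -/
def IsCompatible (M : MatchedPair k H U) (ρA : A →ₗ[k] A ⊗[k] H) (ρR : R →ₗ[k] R ⊗[k] U)
    (θ : TwistingMap k A R) : Prop :=
  tensorCoaction ρA ρR ∘ₗ θ.toLinearMap =
    TensorProduct.map θ.toLinearMap M.omega ∘ₗ tensorCoaction ρR ρA

/-- The map `A #_θ R → (A #_θ R) ⊗ (H ⋈ U)`, `a # r ↦ (a₍₀₎ # r₍₀₎) ⊗ (a₍₁₎ ⋈ r₍₁₎)`. -/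
def twistedCoaction (M : MatchedPair k H U) (ρA : A →ₗ[k] A ⊗[k] H) (ρR : R →ₗ[k] R ⊗[k] U)
    (θ : TwistingMap k A R) :
    TwistedTensor θ →ₗ[k] TwistedTensor θ ⊗[k] BicrossedProduct M :=
  TensorProduct.map (TwistedTensor.of θ).toLinearMap
    (TwistedTensor.of M.twisting).toLinearMap ∘ₗ
    tensorCoaction ρA ρR ∘ₗ (TwistedTensor.of θ).symm.toLinearMap

end Coaction

end

end HopfGalois

open HopfGalois

universe w

namespace HopfGalois

noncomputable section

/-! ### Galois maps along algebra homomorphisms -/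

section GaloisAlong

variable {k : Type*} [Field k] {H : Type*} [Ring H] [HopfAlgebra k H]
  {A : Type*} [Ring A] [Algebra k A] {J : Type*} [Ring J] [Algebra k J]

/-! Everything is governed by the multiplication map `m : A ⊗ R → J`, `a ⊗ r ↦ f(a) g(r)`, for
algebra maps from an `H`-Galois object `A` and a `U`-Galois object `R` into an algebra `J` with an
`H ⋈ U`-coaction. If `m` respects the coactions, then the Galois map of `J` composed with `id_J ⊗ m`
is, up to the identification `H ⊗ U = H ⋈ U`, the composite `J ⊗ A ⊗ R → J ⊗ H ⊗ R → J ⊗ H ⊗ U` of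
base changes of the Galois maps of `A` and `R`. Those are bijective (`bijective_galoisAlong`), so
the composite is too (`bijective_galoisMap_comp_mulMap`). This is used in both directions.

For a twisted tensor product `m` is bijective, hence the Galois map of `A #_θ R` is bijective.
Compatibility of `θ` says that the coaction is multiplicative on products `r · a`, which suffices,
as `(a # r)(b # s) = a (r b) s`. The coinvariants lie in `A ⊗ k` and in `k ⊗ R`, hence in `k`.

Conversely, given an `H ⋈ U`-Galois object `J`, let `A` and `R` consist of the elements whose
coaction lies in `J ⊗ H` and `J ⊗ U` respectively. They are Galois objects because the translation
map `κ(d) = can⁻¹(1 ⊗ d)` of `J`, where `can` is its Galois map, sends a Hopf subalgebra `D` into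
the square of the corresponding subalgebra: the left leg of `κ(d)` coacts through `S(d₍₁₎)` and the
right leg through `d₍₂₎` (`IsGaloisObject.restrict`). Now the Galois map of `J` is bijective, so
`id_J ⊗ m` is bijective, and so is `m` by faithful flatness. Transporting the product of `J` along
`m` gives `θ` (`exists_twistingMap`).

For the classification, `A` and `R` are recovered inside `A #_θ R` as the coinvariants along the
coalgebra projections `H ⋈ U → U` and `H ⋈ U → H` (`mem_range_inl`, `mem_range_inr`). Colinear
isomorphisms preserve these subalgebras, and multiplicativity forces the relation between the
twisting maps. -/

theorem galoisMap_tmul (ρ : A →ₗ[k] A ⊗[k] H) (a b : A) :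
    galoisMap ρ (a ⊗ₜ b) = (a ⊗ₜ 1) * ρ b := by
  simp only [galoisMap, LinearMap.comp_apply, LinearMap.lTensor_tmul, LinearEquiv.coe_coe]
  induction ρ b with
  | zero => simp
  | add x y hx hy => simp only [TensorProduct.tmul_add, map_add, mul_add, hx, hy]
  | tmul x h => simp

/-- For an algebra homomorphism `f : A → J`, the map `J ⊗ A → J ⊗ H`,
`x ⊗ a ↦ x f(a₍₀₎) ⊗ a₍₁₎`. -/
def galoisAlong (f : A →ₐ[k] J) (ρ : A →ₗ[k] A ⊗[k] H) : J ⊗[k] A →ₗ[k] J ⊗[k] H :=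
  TensorProduct.lift ((LinearMap.mul k (J ⊗[k] H)).compl₁₂ ((TensorProduct.mk k J H).flip 1)
    (TensorProduct.map f.toLinearMap LinearMap.id ∘ₗ ρ))

theorem galoisAlong_tmul (f : A →ₐ[k] J) (ρ : A →ₗ[k] A ⊗[k] H) (x : J) (a : A) :
    galoisAlong f ρ (x ⊗ₜ a) =
      (x ⊗ₜ 1) * TensorProduct.map f.toLinearMap LinearMap.id (ρ a) := rfl

theorem map_mul_tmul_one {M : Type*} [Ring M] [Algebra k M] (f : A →ₐ[k] J) (a : A)
    (z : A ⊗[k] M) :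
    TensorProduct.map f.toLinearMap LinearMap.id ((a ⊗ₜ 1) * z) =
      (f a ⊗ₜ 1) * TensorProduct.map f.toLinearMap (LinearMap.id : M →ₗ[k] M) z := by
  induction z with
  | zero => simp
  | add x y hx hy => simp only [map_add, mul_add, hx, hy]
  | tmul b m => simp

theorem galoisAlong_mul (f : A →ₐ[k] J) (ρ : A →ₗ[k] A ⊗[k] H) (x : J) (z : J ⊗[k] A) :
    galoisAlong f ρ ((x ⊗ₜ 1) * z) = (x ⊗ₜ 1) * galoisAlong f ρ z := by
  induction z with
  | zero => simp
  | add x y hx hy => simp only [map_add, mul_add, hx, hy]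
  | tmul y a =>
    rw [Algebra.TensorProduct.tmul_mul_tmul, one_mul, galoisAlong_tmul, galoisAlong_tmul,
      ← mul_assoc, Algebra.TensorProduct.tmul_mul_tmul, one_mul]

theorem galoisAlong_id (ρ : A →ₗ[k] A ⊗[k] H) : galoisAlong (AlgHom.id k A) ρ = galoisMap ρ := by
  refine TensorProduct.ext' fun x a => ?_
  rw [galoisAlong_tmul, galoisMap_tmul]
  congr 1
  exact congrArg (fun g : A ⊗[k] H →ₗ[k] A ⊗[k] H => g (ρ a)) TensorProduct.map_id

theorem galoisMap_mul (ρ : A →ₗ[k] A ⊗[k] H) (x : A) (z : A ⊗[k] A) :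
    galoisMap ρ ((x ⊗ₜ 1) * z) = (x ⊗ₜ 1) * galoisMap ρ z := by
  rw [← galoisAlong_id, galoisAlong_mul]

theorem galoisAlong_map (f : A →ₐ[k] J) (ρ : A →ₗ[k] A ⊗[k] H) (z : A ⊗[k] A) :
    galoisAlong f ρ (TensorProduct.map f.toLinearMap LinearMap.id z) =
      TensorProduct.map f.toLinearMap LinearMap.id (galoisMap ρ z) := by
  induction z with
  | zero => simp
  | add x y hx hy => simp only [map_add, hx, hy]
  | tmul a b => rw [galoisMap_tmul, map_mul_tmul_one]; rfl

/-- The Galois map of `A` is left `A`-linear, and `galoisAlong f ρ` is its base change `J ⊗_A -`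
along `f`. The inverse is written out explicitly from the translation map, so no tensor product over
`A` is needed. -/
theorem bijective_galoisAlong (f : A →ₐ[k] J) {ρ : A →ₗ[k] A ⊗[k] H}
    (hρ : Function.Bijective (galoisMap ρ)) : Function.Bijective (galoisAlong f ρ) := by
  let κ := (LinearEquiv.ofBijective _ hρ).symm
  have hκ : ∀ z, galoisMap ρ (κ z) = z := (LinearEquiv.ofBijective _ hρ).apply_symm_apply
  have hκ' : ∀ z, κ (galoisMap ρ z) = z := (LinearEquiv.ofBijective _ hρ).symm_apply_apply
  -- The inverse of a left `A`-linear bijection is left `A`-linear; hence `κ` is determined by the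
  -- translation map `h ↦ κ (1 ⊗ₜ h)`.
  have κ_mul : ∀ a z, κ ((a ⊗ₜ 1) * z) = (a ⊗ₜ 1) * κ z := fun a z =>
    hρ.1 (by rw [hκ, galoisMap_mul, hκ])
  let T : J ⊗[k] H →ₗ[k] J ⊗[k] A :=
    TensorProduct.lift ((LinearMap.mul k (J ⊗[k] A)).compl₁₂ ((TensorProduct.mk k J A).flip 1)
      (TensorProduct.map f.toLinearMap LinearMap.id ∘ₗ κ.toLinearMap ∘ₗ TensorProduct.mk k A H 1))
  have hT : ∀ x h, T (x ⊗ₜ h) =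
      (x ⊗ₜ 1) * TensorProduct.map f.toLinearMap LinearMap.id (κ (1 ⊗ₜ h)) := fun _ _ => rfl
  have T_mul : ∀ x z, T ((x ⊗ₜ 1) * z) = (x ⊗ₜ 1) * T z := by
    intro x z
    induction z with
    | zero => simp
    | add x y hx hy => simp only [map_add, mul_add, hx, hy]
    | tmul y a =>
      rw [Algebra.TensorProduct.tmul_mul_tmul, one_mul, hT, hT,
        ← mul_assoc, Algebra.TensorProduct.tmul_mul_tmul, one_mul]
  have T_map : ∀ z, T (TensorProduct.map f.toLinearMap LinearMap.id z) =
      TensorProduct.map f.toLinearMap LinearMap.id (κ z) := by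
    intro z
    induction z with
    | zero => simp
    | add x y hx hy => simp only [map_add, hx, hy]
    | tmul a h =>
      have : a ⊗ₜ[k] h = (a ⊗ₜ 1) * (1 ⊗ₜ h) := by simp
      rw [TensorProduct.map_tmul, hT, this, κ_mul, map_mul_tmul_one]; rfl
  refine Function.bijective_iff_has_inverse.2 ⟨T, fun z => ?_, fun z => ?_⟩
  · induction z with
    | zero => simp
    | add x y hx hy => simp only [map_add, hx, hy]
    | tmul x a =>
      have : ρ a = galoisMap ρ (1 ⊗ₜ a) := by
        rw [galoisMap_tmul, ← Algebra.TensorProduct.one_def, one_mul]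
      rw [galoisAlong_tmul, T_mul, T_map, this, hκ']
      simp
  · induction z with
    | zero => simp
    | add x y hx hy => simp only [map_add, hx, hy]
    | tmul x a =>
      rw [hT, galoisAlong_mul, galoisAlong_map, hκ]
      simp

end GaloisAlong

/-! ### Flatness over a field and intersections of tensor subspaces -/

section Linear

variable {k : Type*} [Field k] {V W X Y Q : Type*} [AddCommGroup V] [Module k V]
  [AddCommGroup W] [Module k W] [AddCommGroup X] [Module k X] [AddCommGroup Y] [Module k Y]
  [AddCommGroup Q] [Module k Q]

theorem rTensor_injective (f : V →ₗ[k] W) (hf : Function.Injective f) :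
    Function.Injective (f.rTensor X) :=
  Module.Flat.rTensor_preserves_injective_linearMap f hf

theorem map_injective (f : V →ₗ[k] W) (hf : Function.Injective f) (g : X →ₗ[k] Y)
    (hg : Function.Injective g) : Function.Injective (TensorProduct.map f g) :=
  TensorProduct.map_injective_of_flat_flat f g hf hg

/-- An element of `W ⊗ Y` lying in both `V ⊗ Y` and `W ⊗ X` lies in `V ⊗ X`, for `V`, `X` the
kernels of `φ`, `ψ`. -/
theorem mem_range_map_of_exact {Q' : Type*} [AddCommGroup Q'] [Module k Q']
    {f : V →ₗ[k] W} {φ : W →ₗ[k] Q} {g : X →ₗ[k] Y} {ψ : Y →ₗ[k] Q'}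
    (hf : Function.Injective f) (hφ : Function.Exact f φ) (hψ : Function.Exact g ψ)
    (z : W ⊗[k] Y) (h₁ : φ.rTensor Y z = 0) (h₂ : ψ.lTensor W z = 0) :
    ∃ w, TensorProduct.map f g w = z := by
  obtain ⟨v, rfl⟩ := (Module.Flat.rTensor_exact Y hφ z).1 h₁
  have h : f.rTensor Q' (ψ.lTensor V v) = 0 := by
    rw [← h₂, ← LinearMap.comp_apply, ← LinearMap.comp_apply, LinearMap.rTensor_comp_lTensor,
      LinearMap.lTensor_comp_rTensor]
  have h' : ψ.lTensor V v = 0 := rTensor_injective f hf (by rw [h, map_zero])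
  obtain ⟨w, rfl⟩ := (Module.Flat.lTensor_exact V hψ v).1 h'
  exact ⟨w, by rw [← LinearMap.comp_apply, LinearMap.rTensor_comp_lTensor]⟩

end Linear

/-! ### Restriction of a Galois object to a Hopf subalgebra -/

section Restrict

variable {k : Type*} [Field k] {D E : Type*} [Ring D] [HopfAlgebra k D] [Ring E] [HopfAlgebra k E]
  {A J : Type*} [Ring A] [Algebra k A] [Ring J] [Algebra k J]

/-- The map `f ⊗ g ↦ f S(g₍₁₎) ⊗ g₍₂₎`. -/
def mulAntipodeComul : E ⊗[k] E →ₗ[k] E ⊗[k] E :=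
  TensorProduct.lift ((LinearMap.mul k (E ⊗[k] E)).compl₁₂ ((TensorProduct.mk k E E).flip 1)
    ((HopfAlgebra.antipode k).rTensor E ∘ₗ Coalgebra.comul))

theorem mulAntipodeComul_tmul (f g : E) : mulAntipodeComul (f ⊗ₜ[k] g) =
    (f ⊗ₜ 1) * (HopfAlgebra.antipode k).rTensor E (Coalgebra.comul g) := rfl

/-- By coassociativity this is `g₍₁₎ S(g₍₂₎) ⊗ g₍₃₎`, which the antipode axiom collapses. The map
`mulAntipodeComul` is the usual candidate for the inverse of the Galois map of `E` coacting on
itself. -/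
theorem mulAntipodeComul_comul (g : E) :
    mulAntipodeComul (Coalgebra.comul (R := k) g) = 1 ⊗ₜ g := by
  have h : ∀ z : E ⊗[k] E, mulAntipodeComul z =
      (LinearMap.mul' k E ∘ₗ (HopfAlgebra.antipode k).lTensor E).rTensor E
        ((TensorProduct.assoc k E E E).symm (Coalgebra.comul.lTensor E z)) := by
    intro z
    induction z with
    | zero => simp
    | add x y hx hy => simp only [map_add, hx, hy]
    | tmul x y =>
      rw [mulAntipodeComul_tmul, LinearMap.lTensor_tmul]
      induction Coalgebra.comul (R := k) y with
      | zero => simp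
      | add x y hx hy => simp only [map_add, mul_add, TensorProduct.tmul_add, hx, hy]
      | tmul p q => simp
  rw [h, Coalgebra.coassoc_symm_apply, ← LinearMap.comp_apply (LinearMap.rTensor _ _),
    ← LinearMap.rTensor_comp, LinearMap.comp_assoc, HopfAlgebra.mul_antipode_lTensor_comul,
    LinearMap.rTensor_comp, LinearMap.comp_apply, Coalgebra.rTensor_counit_comul]
  simp

/-- `(J ⊗ Q) ⊗ J → (J ⊗ Q) ⊗ E`, `x ⊗ q ⊗ y ↦ x y₍₀₎ ⊗ q ⊗ y₍₁₎`. -/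
def galoisMapRight (ρ : J →ₗ[k] J ⊗[k] E) (Q : Type*) [AddCommGroup Q] [Module k Q] :
    (J ⊗[k] Q) ⊗[k] J →ₗ[k] (J ⊗[k] Q) ⊗[k] E :=
  (TensorProduct.rightComm k J E Q).toLinearMap ∘ₗ (galoisMap ρ).rTensor Q ∘ₗ
    (TensorProduct.rightComm k J Q J).toLinearMap

/-- Flatness over `k` preserves injectivity. This allows vanishing statements about the left leg of
an element of `J ⊗ J`, after a coaction, to be tested on the image under the Galois map. -/
theorem injective_galoisMapRight {ρ : J →ₗ[k] J ⊗[k] E}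
    (hρ : Function.Injective (galoisMap ρ)) (Q : Type*) [AddCommGroup Q] [Module k Q] :
    Function.Injective (galoisMapRight ρ Q) := by
  simp only [galoisMapRight, LinearMap.coe_comp, LinearEquiv.coe_coe]
  exact (LinearEquiv.injective _).comp
    ((rTensor_injective _ hρ).comp (LinearEquiv.injective _))

theorem galoisMapRight_tmul (ρ : J →ₗ[k] J ⊗[k] E) (Q : Type*) [AddCommGroup Q] [Module k Q]
    (x : J) (q : Q) (y : J) : galoisMapRight ρ Q ((x ⊗ₜ q) ⊗ₜ y) =
      TensorProduct.rightComm k J E Q (((x ⊗ₜ 1) * ρ y) ⊗ₜ q) := by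
  simp [galoisMapRight, galoisMap_tmul]

theorem galoisMapRight_naturality (ρ : J →ₗ[k] J ⊗[k] E) {Q Q' : Type*} [AddCommGroup Q]
    [Module k Q] [AddCommGroup Q'] [Module k Q'] (q : Q →ₗ[k] Q') (z : (J ⊗[k] Q) ⊗[k] J) :
    galoisMapRight ρ Q' ((q.lTensor J).rTensor J z) =
      (q.lTensor J).rTensor E (galoisMapRight ρ Q z) := by
  have h : galoisMapRight ρ Q' ∘ₗ (q.lTensor J).rTensor J =
      (q.lTensor J).rTensor E ∘ₗ galoisMapRight ρ Q := by
    refine TensorProduct.ext_threefold fun x p y => ?_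
    simp only [LinearMap.comp_apply, LinearMap.rTensor_tmul, LinearMap.lTensor_tmul,
      galoisMapRight_tmul]
    induction (x ⊗ₜ 1) * ρ y with
    | zero => simp
    | add x y hx hy => simp only [map_add, TensorProduct.add_tmul, hx, hy]
    | tmul a e => simp
  exact LinearMap.congr_fun h z

/-- Both sides are `x y₍₀₎ ⊗ y₍₁₎ ⊗ y₍₂₎` for `w = x ⊗ y`, by coassociativity. When `w` is the
translation of `h`, it says that the right leg of `w` coacts through `h₍₂₎`. -/
theorem galoisMap_colinear {ρ : J →ₗ[k] J ⊗[k] E} (hρ : IsComoduleAlgebra ρ) (w : J ⊗[k] J) :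
    (galoisMap ρ).rTensor E ((TensorProduct.assoc k J J E).symm (ρ.lTensor J w)) =
      (TensorProduct.assoc k J E E).symm (Coalgebra.comul.lTensor J (galoisMap ρ w)) := by
  have h1 : ∀ (x : J) (z : J ⊗[k] E),
      (galoisMap ρ).rTensor E ((TensorProduct.assoc k J J E).symm (x ⊗ₜ z)) =
      ((x ⊗ₜ 1) ⊗ₜ 1) * ρ.rTensor E z := by
    intro x z
    induction z with
    | zero => simp
    | add x y hx hy => simp only [TensorProduct.tmul_add, map_add, mul_add, hx, hy]
    | tmul y e => simp [galoisMap_tmul]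
  have h2 : ∀ (x : J) (z : J ⊗[k] E),
      (TensorProduct.assoc k J E E).symm (Coalgebra.comul.lTensor J ((x ⊗ₜ 1) * z)) =
      ((x ⊗ₜ 1) ⊗ₜ 1) * (TensorProduct.assoc k J E E).symm (Coalgebra.comul.lTensor J z) := by
    intro x z
    induction z with
    | zero => simp
    | add x y hx hy => simp only [map_add, mul_add, hx, hy]
    | tmul y e =>
      simp only [Algebra.TensorProduct.tmul_mul_tmul, one_mul, LinearMap.lTensor_tmul]
      induction Coalgebra.comul (R := k) e with
      | zero => simp
      | add x y hx hy => simp only [TensorProduct.tmul_add, map_add, mul_add, hx, hy]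
      | tmul p q => simp
  induction w with
  | zero => simp
  | add x y hx hy => simp only [map_add, hx, hy]
  | tmul x y =>
    rw [LinearMap.lTensor_tmul, h1, galoisMap_tmul, h2]
    congr 1
    rw [LinearEquiv.eq_symm_apply]
    exact LinearMap.congr_fun hρ.coassoc y

/-- For `w = x ⊗ y` the right side is `x₍₀₎ y₍₀₎ ⊗ x₍₁₎ y₍₁₎ S(y₍₂₎) ⊗ y₍₃₎`, and the antipode
removes the middle `y`-factors. When `w` is the translation of `h`, the right side becomes `1 ⊗
S(h₍₁₎) ⊗ h₍₂₎`: the left leg of `w` coacts through `S(h₍₁₎)`. -/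
theorem galoisMapRight_rTensor {ρ : J →ₗ[k] J ⊗[k] E} (hρ : IsComoduleAlgebra ρ)
    (w : J ⊗[k] J) :
    galoisMapRight ρ E (ρ.rTensor J w) =
      (TensorProduct.assoc k J E E).symm (mulAntipodeComul.lTensor J
        (TensorProduct.assoc k J E E (ρ.rTensor E (galoisMap ρ w)))) := by
  let μ : (J ⊗[k] E) ⊗[k] E →ₗ[k] (J ⊗[k] E) ⊗[k] E :=
    (TensorProduct.assoc k J E E).symm.toLinearMap ∘ₗ mulAntipodeComul.lTensor J ∘ₗ
      (TensorProduct.assoc k J E E).toLinearMap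
  change _ = μ _
  -- `μ` is left linear over `J ⊗ E`, so the contribution of `x` can be pulled out and only `y`
  -- remains to be computed, in `μ_ρ`.
  have μ_mul : ∀ (p : J ⊗[k] E) (z : (J ⊗[k] E) ⊗[k] E),
      μ ((p ⊗ₜ 1) * z) = (p ⊗ₜ 1) * μ z := by
    intro p z
    induction p with
    | zero => simp
    | add x y hx hy => simp only [map_add, add_mul, TensorProduct.add_tmul, hx, hy]
    | tmul x e =>
    induction z with
    | zero => simp
    | add x y hx hy => simp only [map_add, mul_add, hx, hy]
    | tmul z g =>
    induction z with
    | zero => simp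
    | add x y hx hy => simp only [map_add, mul_add, TensorProduct.add_tmul, hx, hy]
    | tmul y f =>
      simp only [μ, Algebra.TensorProduct.tmul_mul_tmul, one_mul, LinearMap.comp_apply,
        LinearEquiv.coe_coe, TensorProduct.assoc_tmul, LinearMap.lTensor_tmul,
        mulAntipodeComul_tmul]
      induction (HopfAlgebra.antipode k).rTensor E (Coalgebra.comul (R := k) g) with
      | zero => simp
      | add x y hx hy => simp only [map_add, mul_add, TensorProduct.tmul_add, hx, hy]
      | tmul p q => simp [mul_assoc]
  have μ_ρ : ∀ y, μ (ρ.rTensor E (ρ y)) =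
      TensorProduct.rightComm k J E E (ρ y ⊗ₜ 1) := by
    intro y
    have : TensorProduct.assoc k J E E (ρ.rTensor E (ρ y)) = Coalgebra.comul.lTensor J (ρ y) :=
      LinearMap.congr_fun hρ.coassoc y
    simp only [μ, LinearMap.comp_apply, LinearEquiv.coe_coe, this]
    induction ρ y with
    | zero => simp
    | add x y hx hy => simp only [map_add, TensorProduct.add_tmul, hx, hy]
    | tmul u g => simp [mulAntipodeComul_comul]
  have ρ_mul : ∀ x z, ρ.rTensor E ((x ⊗ₜ 1) * z) = (ρ x ⊗ₜ 1) * ρ.rTensor E z := by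
    intro x z
    induction z with
    | zero => simp
    | add x y hx hy => simp only [map_add, mul_add, hx, hy]
    | tmul y e => simp [hρ.map_mul]
  induction w with
  | zero => simp
  | add x y hx hy => simp only [map_add, hx, hy]
  | tmul x y =>
    rw [LinearMap.rTensor_tmul, galoisMap_tmul, ρ_mul, μ_mul, μ_ρ]
    induction ρ x with
    | zero => simp
    | add x y hx hy => simp only [map_add, TensorProduct.add_tmul, add_mul, hx, hy]
    | tmul p e =>
      rw [galoisMapRight_tmul]
      induction ρ y with
      | zero => simp
      | add x y hx hy => simp only [map_add, TensorProduct.add_tmul, mul_add, hx, hy]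
      | tmul q f => simp

end Restrict

/-! ### The subalgebra of elements coacting into a Hopf subalgebra -/

section Restrict

variable {k : Type*} [Field k] {D E : Type*} [Ring D] [HopfAlgebra k D] [Ring E] [HopfAlgebra k E]
  {A J : Type*} [Ring A] [Algebra k A] [Ring J] [Algebra k J]

/-- The condition `ρ(j) ∈ J ⊗ D` means that `ρ(j)` dies in `J ⊗ E/D`. Presenting `A` as a kernel
makes membership in `A ⊗ A` a pair of vanishing conditions. -/
theorem exact_restrict {i : D →ₐ[k] E} {ι : A →ₐ[k] J} {ρ : J →ₗ[k] J ⊗[k] E}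
    {ρA : A →ₗ[k] A ⊗[k] D}
    (hρA : ∀ a, ρ (ι a) = TensorProduct.map ι.toLinearMap i.toLinearMap (ρA a))
    (hA : ∀ j, ρ j ∈ LinearMap.range (i.toLinearMap.lTensor J) → j ∈ LinearMap.range ι.toLinearMap) :
    Function.Exact ι.toLinearMap
      ((LinearMap.range i.toLinearMap).mkQ.lTensor J ∘ₗ ρ) := by
  have hq := Module.Flat.lTensor_exact J (LinearMap.exact_map_mkQ_range i.toLinearMap)
  intro j
  constructor
  · intro h
    exact hA j ((hq (ρ j)).1 h)
  · rintro ⟨a, rfl⟩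
    refine (hq _).2 ⟨ι.toLinearMap.rTensor D (ρA a), ?_⟩
    rw [← LinearMap.comp_apply, LinearMap.lTensor_comp_rTensor]
    exact (hρA a).symm

/-- If `D` is a Hopf subalgebra of `E` and `J` is an `E`-Galois object, then
`A = {j ∈ J | ρ(j) ∈ J ⊗ D}` is a `D`-Galois object. -/
theorem IsGaloisObject.restrict {i : D →ₐ[k] E} (hi : Function.Injective i)
    (hcomul : ∀ d, Coalgebra.comul (R := k) (i d) =
      TensorProduct.map i.toLinearMap i.toLinearMap (Coalgebra.comul (R := k) d))
    (hcounit : ∀ d, Coalgebra.counit (R := k) (i d) = Coalgebra.counit (R := k) d)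
    (hantipode : ∀ d, HopfAlgebra.antipode k (i d) = i (HopfAlgebra.antipode k d))
    {ι : A →ₐ[k] J} (hι : Function.Injective ι)
    {ρ : J →ₗ[k] J ⊗[k] E} (hρ : IsGaloisObject ρ) {ρA : A →ₗ[k] A ⊗[k] D}
    (hρA : ∀ a, ρ (ι a) = TensorProduct.map ι.toLinearMap i.toLinearMap (ρA a))
    (hA : ∀ j, ρ j ∈ LinearMap.range (i.toLinearMap.lTensor J) →
      j ∈ LinearMap.range ι.toLinearMap) :
    IsGaloisObject ρA := by
  have hi' : Function.Injective i.toLinearMap := hi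
  have hι' : Function.Injective ι.toLinearMap := hι
  let F : A ⊗[k] D →ₐ[k] J ⊗[k] E := Algebra.TensorProduct.map ι i
  have hF : Function.Injective F := map_injective _ hι' _ hi'
  have hρA' : ∀ a, ρ (ι a) = F (ρA a) := hρA
  have := hρ.nontrivial
  have hAnt : Nontrivial A := by
    refine ⟨1, 0, fun h => one_ne_zero (α := J) ?_⟩
    rw [← map_one ι, h, map_zero]
  have hβ : ∀ w, TensorProduct.map ι.toLinearMap i.toLinearMap (galoisMap ρA w) =
      galoisMap ρ (TensorProduct.map ι.toLinearMap ι.toLinearMap w) := by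
    intro w
    change F _ = _
    induction w with
    | zero => simp
    | add x y hx hy => simp only [map_add, hx, hy]
    | tmul a b =>
      rw [galoisMap_tmul, map_mul, TensorProduct.map_tmul, galoisMap_tmul]
      refine congrArg₂ _ ?_ (hρA' b).symm
      simp [F]
  refine { coassoc := ?_, counit := ?_, map_one := ?_, map_mul := ?_, nontrivial := hAnt,
           coinvariants_eq := ?_, bijective := ⟨?_, ?_⟩ }
  -- Each comodule algebra axiom for `ρA` is checked after an injection built from `ι` and `i`,
  -- where it becomes the axiom for `ρ`.
  · refine LinearMap.ext fun a => ?_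
    refine map_injective _ hι' _ (map_injective _ hi' _ hi') ?_
    have h := LinearMap.congr_fun hρ.coassoc (ι a)
    simp only [LinearMap.comp_apply, LinearEquiv.coe_coe, hρA] at h ⊢
    have e1 : ∀ z : A ⊗[k] D, TensorProduct.map ι.toLinearMap
        (TensorProduct.map i.toLinearMap i.toLinearMap)
          (TensorProduct.assoc k A D D (ρA.rTensor D z)) =
        TensorProduct.assoc k J E E (ρ.rTensor E
          (TensorProduct.map ι.toLinearMap i.toLinearMap z)) := by
      intro z
      induction z with
      | zero => simp
      | add x y hx hy => simp only [map_add, hx, hy]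
      | tmul b d =>
        rw [LinearMap.rTensor_tmul, TensorProduct.map_tmul, LinearMap.rTensor_tmul]
        erw [hρA b]
        induction ρA b with
        | zero => simp
        | add x y hx hy => simp only [map_add, TensorProduct.add_tmul, hx, hy]
        | tmul p q => simp
    have e2 : ∀ z : A ⊗[k] D, TensorProduct.map ι.toLinearMap
        (TensorProduct.map i.toLinearMap i.toLinearMap) (Coalgebra.comul.lTensor A z) =
        Coalgebra.comul.lTensor J (TensorProduct.map ι.toLinearMap i.toLinearMap z) := by
      intro z
      induction z with
      | zero => simp
      | add x y hx hy => simp only [map_add, hx, hy]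
      | tmul b d => simp [hcomul]
    rw [e1, e2, h]
  · refine LinearMap.ext fun a => rTensor_injective (X := k) ι.toLinearMap hι' ?_
    have h := LinearMap.congr_fun hρ.counit (ι a)
    simp only [LinearMap.comp_apply, hρA] at h ⊢
    have e : ∀ z : A ⊗[k] D, ι.toLinearMap.rTensor k (Coalgebra.counit.lTensor A z) =
        Coalgebra.counit.lTensor J (TensorProduct.map ι.toLinearMap i.toLinearMap z) := by
      intro z
      induction z with
      | zero => simp
      | add x y hx hy => simp only [map_add, hx, hy]
      | tmul b d => simp [hcounit]
    rw [e, h]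
    simp
  · apply hF
    rw [← hρA', map_one ι, hρ.map_one, map_one F]
  · intro a b
    apply hF
    rw [← hρA', map_mul ι, hρ.map_mul, hρA', hρA', map_mul F]
  · ext a
    constructor
    · intro h
      have h' : ρA a = a ⊗ₜ 1 := h
      have : ι a ∈ coinvariants ρ := by
        change ρ (ι a) = ι a ⊗ₜ 1
        rw [hρA, h']
        simp
      rw [hρ.coinvariants_eq] at this
      obtain ⟨c, hc⟩ := this
      refine ⟨c, hι ?_⟩
      rw [← hc]
      simp
    · rintro ⟨c, rfl⟩
      change ρA (algebraMap k A c) = algebraMap k A c ⊗ₜ 1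
      apply hF
      rw [← hρA', Algebra.algebraMap_eq_smul_one, map_smul, map_one, map_smul, hρ.map_one,
        ← TensorProduct.smul_tmul', map_smul, ← Algebra.TensorProduct.one_def, map_one]
  · intro z w h
    refine map_injective _ hι' _ hι' (hρ.bijective.1 ?_)
    rw [← hβ, ← hβ, h]
  -- Surjectivity: the translation `κ ∈ J ⊗ J` of `i d` has to be shown to lie in `A ⊗ A`.
  · have key : ∀ d : D, ∃ w, galoisMap ρA w = 1 ⊗ₜ d := by
      intro d
      obtain ⟨κ, hκ⟩ := hρ.bijective.2 (1 ⊗ₜ i d)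
      let q := (LinearMap.range i.toLinearMap).mkQ
      have hq : q ∘ₗ i.toLinearMap = 0 := LinearMap.range_mkQ_comp _
      have hex := exact_restrict hρA hA
      -- Under `galoisMapRight` the coaction on the left leg becomes `1 ⊗ S(d₍₁₎) ⊗ d₍₂₎`; since `D`
      -- is stable under the antipode, `q` kills `S(d₍₁₎)`.
      have h₁ : (q.lTensor J ∘ₗ ρ).rTensor J κ = 0 := by
        apply injective_galoisMapRight hρ.bijective.1
        rw [LinearMap.rTensor_comp, LinearMap.comp_apply, galoisMapRight_naturality,
          galoisMapRight_rTensor hρ.toIsComoduleAlgebra, hκ, LinearMap.rTensor_tmul, hρ.map_one,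
          Algebra.TensorProduct.one_def, TensorProduct.assoc_tmul, LinearMap.lTensor_tmul,
          mulAntipodeComul_tmul, ← Algebra.TensorProduct.one_def, one_mul, hcomul, map_zero]
        induction Coalgebra.comul (R := k) d with
        | zero => simp
        | add x y hx hy => simp only [map_add, TensorProduct.tmul_add, hx, hy, add_zero]
        | tmul p p' =>
          have : q (i (HopfAlgebra.antipode k p)) = 0 := LinearMap.congr_fun hq _
          simp [hantipode, this]
      -- Under the Galois map the coaction on the right leg becomes `1 ⊗ d₍₁₎ ⊗ d₍₂₎`, and `q` kills
      -- `d₍₂₎ ∈ D`.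
      have h₂ : (q.lTensor J ∘ₗ ρ).lTensor J κ = 0 := by
        apply (TensorProduct.assoc k J J _).symm.injective
        apply rTensor_injective _ hρ.bijective.1
        have e : ∀ z : J ⊗[k] (J ⊗[k] E), (galoisMap ρ).rTensor _
            ((TensorProduct.assoc k J J _).symm ((q.lTensor J).lTensor J z)) =
            q.lTensor (J ⊗[k] E)
              ((galoisMap ρ).rTensor _ ((TensorProduct.assoc k J J E).symm z)) := by
          intro z
          induction z with
          | zero => simp
          | add x y hx hy => simp only [map_add, hx, hy]
          | tmul x z =>
            induction z with
            | zero => simp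
            | add x y hx hy => simp only [map_add, TensorProduct.tmul_add, hx, hy]
            | tmul y e => simp
        rw [LinearMap.lTensor_comp, LinearMap.comp_apply, e,
          galoisMap_colinear hρ.toIsComoduleAlgebra, hκ, LinearMap.lTensor_tmul, hcomul,
          map_zero, map_zero]
        induction Coalgebra.comul (R := k) d with
        | zero => simp
        | add x y hx hy => simp only [map_add, TensorProduct.tmul_add, hx, hy, add_zero]
        | tmul p p' =>
          have : q (i p') = 0 := LinearMap.congr_fun hq _
          simp [this]
      obtain ⟨w, hw⟩ := mem_range_map_of_exact hι' hex hex κ h₁ h₂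
      refine ⟨w, map_injective _ hι' _ hi' ?_⟩
      rw [hβ, hw, hκ]
      simp
    intro z
    induction z with
    | zero => exact ⟨0, map_zero _⟩
    | add x y hx hy =>
      obtain ⟨v, rfl⟩ := hx
      obtain ⟨w, rfl⟩ := hy
      exact ⟨v + w, map_add _ _ _⟩
    | tmul a d =>
      obtain ⟨w, hw⟩ := key d
      exact ⟨(a ⊗ₜ 1) * w, by rw [galoisMap_mul, hw]; simp⟩

/-- For `ρ(a) ∈ J ⊗ D`, coassociativity gives `(ρ ⊗ id)ρ(a) ∈ J ⊗ D ⊗ D`, so `ρ(a)` also lies in `S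
⊗ E`. Hence `ρ(a) ∈ (S ⊗ E) ∩ (J ⊗ D) = S ⊗ D`, and `ρ` corestricts. -/
theorem exists_restrict {i : D →ₐ[k] E} (hi : Function.Injective i)
    (hcomul : ∀ d, Coalgebra.comul (R := k) (i d) =
      TensorProduct.map i.toLinearMap i.toLinearMap (Coalgebra.comul (R := k) d))
    {ρ : J →ₗ[k] J ⊗[k] E} (hρ : IsComoduleAlgebra ρ) :
    ∃ (S : Subalgebra k J) (ρA : S →ₗ[k] S ⊗[k] D),
      (∀ a, ρ (S.val a) = TensorProduct.map S.val.toLinearMap i.toLinearMap (ρA a)) ∧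
      ∀ j, ρ j ∈ LinearMap.range (i.toLinearMap.lTensor J) →
        j ∈ LinearMap.range S.val.toLinearMap := by
  have hi' : Function.Injective i.toLinearMap := hi
  let S : Subalgebra k J := (Algebra.TensorProduct.map (AlgHom.id k J) i).range.comap
    (AlgHom.ofLinearMap ρ hρ.map_one hρ.map_mul)
  have hS : ∀ j, j ∈ S ↔ ρ j ∈ LinearMap.range (i.toLinearMap.lTensor J) := fun j => Iff.rfl
  have hS' : Function.Injective S.val.toLinearMap := Subtype.val_injective
  let q := (LinearMap.range i.toLinearMap).mkQ
  have hexi : Function.Exact i.toLinearMap q := LinearMap.exact_map_mkQ_range _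
  have hq := Module.Flat.lTensor_exact J hexi
  have hexS : Function.Exact S.val.toLinearMap (q.lTensor J ∘ₗ ρ) := by
    intro j
    rw [LinearMap.comp_apply, hq (ρ j)]
    refine (hS j).symm.trans ⟨fun h => ⟨⟨j, h⟩, rfl⟩, ?_⟩
    rintro ⟨a, rfl⟩
    exact a.2
  let T := TensorProduct.map S.val.toLinearMap i.toLinearMap
  have hT : Function.Injective T := map_injective _ hS' _ hi'
  have hmem : ∀ a : S, (ρ ∘ₗ S.val.toLinearMap) a ∈ LinearMap.range T := by
    intro a
    obtain ⟨z, hz⟩ := (hS a.1).1 a.2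
    refine mem_range_map_of_exact hS' hexS hexi _ ?_ ((hexS a.1).2 ⟨a, rfl⟩)
    have h : ρ.rTensor E (ρ a.1) = (TensorProduct.assoc k J E E).symm
        (Coalgebra.comul.lTensor J (ρ a.1)) := by
      rw [LinearEquiv.eq_symm_apply]
      exact LinearMap.congr_fun hρ.coassoc a.1
    rw [LinearMap.rTensor_comp, LinearMap.comp_apply]
    refine (congrArg _ h).trans ?_
    rw [← hz]
    clear hz
    induction z with
    | zero => simp
    | add x y hx hy => simp only [map_add, hx, hy, add_zero]
    | tmul x d =>
      rw [LinearMap.lTensor_tmul, LinearMap.lTensor_tmul, AlgHom.toLinearMap_apply, hcomul]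
      induction Coalgebra.comul (R := k) d with
      | zero => simp
      | add x y hx hy => simp only [map_add, TensorProduct.tmul_add, hx, hy, add_zero]
      | tmul p p' =>
        have : q (i p) = 0 := (hexi _).2 ⟨p, rfl⟩
        simp [this]
  refine ⟨S, (LinearEquiv.ofInjective T hT).symm.toLinearMap ∘ₗ
    (ρ ∘ₗ S.val.toLinearMap).codRestrict _ hmem, fun a => ?_, fun j hj => ⟨⟨j, hj⟩, rfl⟩⟩
  have := (LinearEquiv.ofInjective T hT).apply_symm_apply
    ((ρ ∘ₗ S.val.toLinearMap).codRestrict _ hmem a)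
  exact (congrArg Subtype.val this).symm

end Restrict

/-! ### Factorizations and twisted tensor products -/

section Factorization

variable {k : Type*} [Field k] {A R J : Type*} [Ring A] [Algebra k A] [Ring R] [Algebra k R]
  [Ring J] [Algebra k J]

/-- The map `A ⊗ R → J`, `a ⊗ r ↦ f(a) g(r)`. -/
def mulMap (f : A →ₐ[k] J) (g : R →ₐ[k] J) : A ⊗[k] R →ₗ[k] J :=
  LinearMap.mul' k J ∘ₗ TensorProduct.map f.toLinearMap g.toLinearMap

@[simp]
theorem mulMap_tmul (f : A →ₐ[k] J) (g : R →ₐ[k] J) (a : A) (r : R) :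
    mulMap f g (a ⊗ₜ r) = f a * g r := rfl

theorem mulMap_map (f : A →ₐ[k] J) (g : R →ₐ[k] J) (a : A) (r : R) (z : A ⊗[k] R) :
    mulMap f g (TensorProduct.map (LinearMap.mulLeft k a) (LinearMap.mulRight k r) z) =
      f a * mulMap f g z * g r := by
  induction z with
  | zero => simp
  | add x y hx hy => simp only [map_add, mul_add, add_mul, hx, hy]
  | tmul b s => simp [mul_assoc]

/-- In `f(a) g(r) f(b) g(s)` only the two middle factors are out of order, so the exchange rule `h`
is all that multiplicativity requires. -/
theorem mulMap_twistedMul {f : A →ₐ[k] J} {g : R →ₐ[k] J} {θ : R ⊗[k] A →ₗ[k] A ⊗[k] R}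
    (h : ∀ r a, mulMap f g (θ (r ⊗ₜ a)) = g r * f a) (z w : A ⊗[k] R) :
    mulMap f g (twistedMul θ z w) = mulMap f g z * mulMap f g w := by
  induction z with
  | zero => simp
  | add x y hx hy => simp only [map_add, LinearMap.add_apply, add_mul, hx, hy]
  | tmul a r =>
    induction w with
    | zero => simp
    | add x y hx hy => simp only [map_add, mul_add, hx, hy]
    | tmul b s =>
      rw [twistedMul_tmul, mulMap_map, h, mulMap_tmul, mulMap_tmul]
      simp only [mul_assoc]

namespace TwistedTensor

variable (θ : TwistingMap k A R)

theorem twist_one_tmul (a : A) : θ.toLinearMap (1 ⊗ₜ a) = a ⊗ₜ 1 := by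
  simpa [twistedMul_tmul] using θ.one_mul (a ⊗ₜ 1)

theorem twist_tmul_one (r : R) : θ.toLinearMap (r ⊗ₜ 1) = 1 ⊗ₜ r := by
  simpa [twistedMul_tmul] using θ.mul_one (1 ⊗ₜ r)

/-- The algebra homomorphism `A → A #_θ R`, `a ↦ a # 1`. -/
def inl : A →ₐ[k] TwistedTensor θ :=
  AlgHom.ofLinearMap ((of θ).toLinearMap ∘ₗ (TensorProduct.mk k A R).flip 1) rfl fun a b =>
    congrArg (of θ) (by simp [twistedMul_tmul, twist_one_tmul] :
      (a * b) ⊗ₜ[k] (1 : R) = twistedMul θ.toLinearMap (a ⊗ₜ 1) (b ⊗ₜ 1))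

/-- The algebra homomorphism `R → A #_θ R`, `r ↦ 1 # r`. -/
def inr : R →ₐ[k] TwistedTensor θ :=
  AlgHom.ofLinearMap ((of θ).toLinearMap ∘ₗ TensorProduct.mk k A R 1) rfl fun r s =>
    congrArg (of θ) (by simp [twistedMul_tmul, twist_tmul_one] :
      (1 : A) ⊗ₜ[k] (r * s) = twistedMul θ.toLinearMap (1 ⊗ₜ r) (1 ⊗ₜ s))

theorem inl_apply (a : A) : inl θ a = of θ (a ⊗ₜ 1) := rfl

theorem inr_apply (r : R) : inr θ r = of θ (1 ⊗ₜ r) := rfl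

theorem of_twist (r : R) (a : A) : of θ (θ.toLinearMap (r ⊗ₜ a)) = inr θ r * inl θ a := by
  rw [inl_apply, inr_apply, of_mul_of, twistedMul_tmul]
  simp

theorem mulMap_inl_inr (z : A ⊗[k] R) : mulMap (inl θ) (inr θ) z = of θ z := by
  induction z with
  | zero => simp
  | add x y hx hy => simp only [map_add, hx, hy]
  | tmul a r =>
    rw [mulMap_tmul, inl_apply, inr_apply, of_mul_of, twistedMul_tmul, twist_one_tmul]
    simp

theorem inl_injective [Nontrivial R] : Function.Injective (inl θ) := by
  have h : Function.Injective (Algebra.TensorProduct.includeLeft : A →ₐ[k] A ⊗[k] R) :=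
    Algebra.TensorProduct.includeLeft_injective (algebraMap k R).injective
  exact (of θ).injective.comp h

theorem inr_injective [Nontrivial A] : Function.Injective (inr θ) := by
  have h : Function.Injective (Algebra.TensorProduct.includeRight : R →ₐ[k] A ⊗[k] R) :=
    Algebra.TensorProduct.includeRight_injective (algebraMap k A).injective
  exact (of θ).injective.comp h

/-- The algebra homomorphism `A #_θ R → J` given by `f : A → J` and `g : R → J`. -/
def lift (f : A →ₐ[k] J) (g : R →ₐ[k] J)
    (h : ∀ r a, mulMap f g (θ.toLinearMap (r ⊗ₜ a)) = g r * f a) : TwistedTensor θ →ₐ[k] J :=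
  AlgHom.ofLinearMap (mulMap f g ∘ₗ (of θ).symm.toLinearMap)
    (by
      change mulMap f g (1 ⊗ₜ 1) = 1
      simp)
    (fun z w => mulMap_twistedMul h _ _)

end TwistedTensor

/-- If `a ⊗ r ↦ f(a) g(r)` is bijective, then it is an isomorphism of algebras `A #_θ R → J` for
the twisting map `θ` determined by `g(r) f(a) = ∑ f(aᵢ) g(rᵢ)` for `θ(r ⊗ a) = ∑ aᵢ ⊗ rᵢ`. -/
theorem exists_twistingMap {f : A →ₐ[k] J} {g : R →ₐ[k] J}
    (h : Function.Bijective (mulMap f g)) :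
    ∃ (θ : TwistingMap k A R) (Φ : TwistedTensor θ ≃ₐ[k] J),
      (∀ z, Φ (TwistedTensor.of θ z) = mulMap f g z) ∧
      ∀ z, mulMap f g (θ.toLinearMap z) = mulMap g f z := by
  let e := LinearEquiv.ofBijective _ h
  have he : ∀ z, mulMap f g (e.symm z) = z := e.apply_symm_apply
  -- The candidate twist rewrites `g(r) f(a)` in the order `A`, `R`. It makes `mulMap f g`
  -- multiplicative, so associativity and the unit laws are pulled back from `J` by injectivity.
  have hm : ∀ z w, mulMap f g (twistedMul (e.symm.toLinearMap ∘ₗ mulMap g f) z w) =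
      mulMap f g z * mulMap f g w := mulMap_twistedMul fun r a => he _
  have h1 : mulMap f g (1 ⊗ₜ 1) = 1 := by simp
  let θ : TwistingMap k A R :=
    { toLinearMap := e.symm.toLinearMap ∘ₗ mulMap g f
      mul_assoc := fun x y z => h.1 (by simp only [hm, mul_assoc])
      one_mul := fun x => h.1 (by rw [hm, h1, one_mul])
      mul_one := fun x => h.1 (by rw [hm, h1, mul_one]) }
  exact ⟨θ, AlgEquiv.ofBijective (TwistedTensor.lift θ f g fun r a => he _)
    (h.comp (TwistedTensor.of θ).symm.bijective), fun z => rfl, fun z => he _⟩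

end Factorization

/-! ### The two factors of a bicrossed product -/

namespace BicrossedProduct

variable {k : Type*} [Field k] {H U : Type*} [Ring H] [HopfAlgebra k H] [Ring U] [HopfAlgebra k U]
  (M : MatchedPair k H U)

open TwistedTensor

theorem comul_inl (a : H) : Coalgebra.comul (R := k) (inl M.twisting a) =
    TensorProduct.map (inl M.twisting).toLinearMap (inl M.twisting).toLinearMap
      (Coalgebra.comul (R := k) a) := by
  rw [inl_apply, comul_of, TensorProduct.comul_tmul, Bialgebra.comul_one]
  induction Coalgebra.comul (R := k) a with
  | zero => simp
  | add x y hx hy => simp only [map_add, TensorProduct.add_tmul, hx, hy]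
  | tmul x y => rfl

theorem comul_inr (x : U) : Coalgebra.comul (R := k) (inr M.twisting x) =
    TensorProduct.map (inr M.twisting).toLinearMap (inr M.twisting).toLinearMap
      (Coalgebra.comul (R := k) x) := by
  rw [inr_apply, comul_of, TensorProduct.comul_tmul, Bialgebra.comul_one]
  induction Coalgebra.comul (R := k) x with
  | zero => simp
  | add x y hx hy => simp only [map_add, TensorProduct.tmul_add, hx, hy]
  | tmul x y => rfl

theorem counit_inl (a : H) : Coalgebra.counit (R := k) (inl M.twisting a) =
    Coalgebra.counit (R := k) a := by
  rw [inl_apply, counit_of]; simp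

theorem counit_inr (x : U) : Coalgebra.counit (R := k) (inr M.twisting x) =
    Coalgebra.counit (R := k) x := by
  rw [inr_apply, counit_of]; simp

theorem antipode_inl (a : H) : HopfAlgebra.antipode k (inl M.twisting a) =
    inl M.twisting (HopfAlgebra.antipode k a) := by
  refine (antipodeMap_of M a 1).trans ?_
  rw [HopfAlgebra.antipode_one, ← one_eq, one_mul]
  rfl

theorem antipode_inr (x : U) : HopfAlgebra.antipode k (inr M.twisting x) =
    inr M.twisting (HopfAlgebra.antipode k x) := by
  refine (antipodeMap_of M 1 x).trans ?_
  rw [HopfAlgebra.antipode_one, ← one_eq, mul_one]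
  rfl

theorem nontrivial_of_hopfAlgebra (k H : Type*) [Field k] [Ring H] [HopfAlgebra k H] :
    Nontrivial H :=
  ⟨1, 0, fun h => one_ne_zero (α := k) (by rw [← Bialgebra.counit_one (R := k) (A := H), h,
    map_zero])⟩

theorem inl_injective : Function.Injective (inl M.twisting) :=
  have := nontrivial_of_hopfAlgebra k U
  TwistedTensor.inl_injective _

theorem inr_injective : Function.Injective (inr M.twisting) :=
  have := nontrivial_of_hopfAlgebra k H
  TwistedTensor.inr_injective _

/-- The coalgebra map `H ⋈ U → U`, `a ⋈ x ↦ ε(a) x`. -/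
def projRight : BicrossedProduct M →ₗ[k] U :=
  (TensorProduct.lid k U).toLinearMap ∘ₗ Coalgebra.counit.rTensor U ∘ₗ
    (of M.twisting).symm.toLinearMap

/-- The coalgebra map `H ⋈ U → H`, `a ⋈ x ↦ ε(x) a`. -/
def projLeft : BicrossedProduct M →ₗ[k] H :=
  (TensorProduct.rid k H).toLinearMap ∘ₗ Coalgebra.counit.lTensor H ∘ₗ
    (of M.twisting).symm.toLinearMap

@[simp]
theorem projRight_of (a : H) (x : U) : projRight M (of M.twisting (a ⊗ₜ x)) =
    Coalgebra.counit (R := k) a • x := rfl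

@[simp]
theorem projLeft_of (a : H) (x : U) : projLeft M (of M.twisting (a ⊗ₜ x)) =
    Coalgebra.counit (R := k) x • a := rfl

theorem projRight_one : projRight M 1 = 1 := by
  rw [one_eq, projRight_of, Bialgebra.counit_one, one_smul]

theorem projLeft_one : projLeft M 1 = 1 := by
  rw [one_eq, projLeft_of, Bialgebra.counit_one, one_smul]

end BicrossedProduct

/-! ### The coaction on a product of two factors and its Galois map -/

section Coaction

variable {k : Type*} [Field k] {H U : Type*} [Ring H] [HopfAlgebra k H] [Ring U] [HopfAlgebra k U]
  (M : MatchedPair k H U)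
  {A R J : Type*} [Ring A] [Algebra k A] [Ring R] [Algebra k R] [Ring J] [Algebra k J]
  (ρA : A →ₗ[k] A ⊗[k] H) (ρR : R →ₗ[k] R ⊗[k] U)

open TwistedTensor

theorem tensorCoaction_tmul (a : A) (r : R) : tensorCoaction ρA ρR (a ⊗ₜ r) =
    TensorProduct.tensorTensorTensorComm k A H R U (ρA a ⊗ₜ ρR r) := rfl

/-- The factorization `h ⋈ u = (h ⋈ 1)(1 ⋈ u)` splits `f(a₍₀₎) g(r₍₀₎) ⊗ (a₍₁₎ ⋈ r₍₁₎)` into a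
product in `J ⊗ (H ⋈ U)`. -/
theorem map_mulMap_tensorCoaction (f : A →ₐ[k] J) (g : R →ₐ[k] J) (a : A) (r : R) :
    TensorProduct.map (mulMap f g) (of M.twisting).toLinearMap (tensorCoaction ρA ρR (a ⊗ₜ r)) =
      Algebra.TensorProduct.map f (inl M.twisting) (ρA a) *
        Algebra.TensorProduct.map g (inr M.twisting) (ρR r) := by
  rw [tensorCoaction_tmul]
  induction ρA a with
  | zero => simp
  | add x y hx hy => simp only [map_add, TensorProduct.add_tmul, add_mul, hx, hy]
  | tmul p h =>
    induction ρR r with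
    | zero => simp
    | add x y hx hy => simp only [map_add, TensorProduct.tmul_add, mul_add, hx, hy]
    | tmul q u => simp [← mulMap_inl_inr]

/-- For the factors in the opposite order, `(1 ⋈ u)(h ⋈ 1) = ω(u ⊗ h)`. This is how `ω`, and thus
the compatibility condition, is tied to multiplicativity of a coaction. -/
theorem map_mulMap_omega_tensorCoaction (f : A →ₐ[k] J) (g : R →ₐ[k] J) (a : A) (r : R) :
    TensorProduct.map (mulMap g f) ((of M.twisting).toLinearMap ∘ₗ M.omega)
        (tensorCoaction ρR ρA (r ⊗ₜ a)) =
      Algebra.TensorProduct.map g (inr M.twisting) (ρR r) *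
        Algebra.TensorProduct.map f (inl M.twisting) (ρA a) := by
  rw [tensorCoaction_tmul]
  induction ρA a with
  | zero => simp
  | add x y hx hy => simp only [map_add, TensorProduct.tmul_add, mul_add, hx, hy]
  | tmul p h =>
    induction ρR r with
    | zero => simp
    | add x y hx hy => simp only [map_add, TensorProduct.add_tmul, add_mul, hx, hy]
    | tmul q u =>
      simp only [TensorProduct.tensorTensorTensorComm_tmul, TensorProduct.map_tmul, mulMap_tmul,
        Algebra.TensorProduct.map_tmul, Algebra.TensorProduct.tmul_mul_tmul]
      congr 1
      exact of_twist M.twisting u h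

/-- The map `J ⊗ A ⊗ R → J ⊗ H ⊗ U`, `x ⊗ a ⊗ r ↦ x f(a₍₀₎) g(r₍₀₎) ⊗ a₍₁₎ ⊗ r₍₁₎`. -/
def galoisAlongPair (f : A →ₐ[k] J) (g : R →ₐ[k] J) :
    J ⊗[k] (A ⊗[k] R) →ₗ[k] J ⊗[k] (H ⊗[k] U) :=
  (TensorProduct.assoc k J H U).toLinearMap ∘ₗ (TensorProduct.rightComm k J U H).toLinearMap ∘ₗ
    (galoisAlong g ρR).rTensor H ∘ₗ (TensorProduct.rightComm k J H R).toLinearMap ∘ₗ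
    (galoisAlong f ρA).rTensor R ∘ₗ (TensorProduct.assoc k J A R).symm.toLinearMap

theorem galoisAlongPair_tmul (f : A →ₐ[k] J) (g : R →ₐ[k] J) (x : J) (a : A) (r : R) :
    galoisAlongPair ρA ρR f g (x ⊗ₜ (a ⊗ₜ r)) =
      (LinearMap.mulLeft k x).rTensor _
        (TensorProduct.map (mulMap f g) LinearMap.id (tensorCoaction ρA ρR (a ⊗ₜ r))) := by
  simp only [galoisAlongPair, tensorCoaction_tmul, LinearMap.comp_apply, LinearEquiv.coe_coe,
    TensorProduct.assoc_symm_tmul, LinearMap.rTensor_tmul, galoisAlong_tmul]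
  induction ρA a with
  | zero => simp
  | add x y hx hy => simp only [map_add, TensorProduct.add_tmul, mul_add, hx, hy]
  | tmul p h =>
    simp only [TensorProduct.map_tmul, Algebra.TensorProduct.tmul_mul_tmul, one_mul,
      TensorProduct.rightComm_tmul, LinearMap.rTensor_tmul, galoisAlong_tmul]
    induction ρR r with
    | zero => simp
    | add x y hx hy =>
      simp only [map_add, TensorProduct.tmul_add, TensorProduct.add_tmul, mul_add, hx, hy]
    | tmul q u => simp [mul_assoc]

variable {ρA ρR}

theorem bijective_rTensor {V W : Type*} (X : Type*) [AddCommGroup V] [Module k V] [AddCommGroup W]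
    [Module k W] [AddCommGroup X] [Module k X] {f : V →ₗ[k] W} (hf : Function.Bijective f) :
    Function.Bijective (f.rTensor X) :=
  ((LinearEquiv.ofBijective f hf).rTensor X).bijective

theorem bijective_galoisAlongPair (f : A →ₐ[k] J) (g : R →ₐ[k] J)
    (hA : Function.Bijective (galoisMap ρA)) (hR : Function.Bijective (galoisMap ρR)) :
    Function.Bijective (galoisAlongPair ρA ρR f g) := by
  have h1 := bijective_rTensor R (bijective_galoisAlong f hA)
  have h2 := bijective_rTensor H (bijective_galoisAlong g hR)
  simp only [galoisAlongPair, LinearMap.coe_comp, LinearEquiv.coe_coe]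
  exact (LinearEquiv.bijective _).comp ((LinearEquiv.bijective _).comp (h2.comp
    ((LinearEquiv.bijective _).comp (h1.comp (LinearEquiv.bijective _)))))

variable {M}

/-- Compatibility of `ρ` with the multiplication map identifies the composite with
`galoisAlongPair`, which is bijective. Neither bijectivity of the multiplication map nor that of
`galoisMap ρ` is assumed, so either one can be deduced from the other. -/
theorem bijective_galoisMap_comp_mulMap {f : A →ₐ[k] J} {g : R →ₐ[k] J}
    (hA : Function.Bijective (galoisMap ρA)) (hR : Function.Bijective (galoisMap ρR))
    {ρ : J →ₗ[k] J ⊗[k] BicrossedProduct M}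
    (hρ : ∀ z, ρ (mulMap f g z) =
      TensorProduct.map (mulMap f g) (of M.twisting).toLinearMap (tensorCoaction ρA ρR z)) :
    Function.Bijective (galoisMap ρ ∘ₗ (mulMap f g).lTensor J) := by
  have h : galoisMap ρ ∘ₗ (mulMap f g).lTensor J =
      (of M.twisting).toLinearMap.lTensor J ∘ₗ galoisAlongPair ρA ρR f g := by
    refine TensorProduct.ext' fun x z => ?_
    induction z with
    | zero => simp
    | add y z hy hz => simp only [map_add, TensorProduct.tmul_add, hy, hz]
    | tmul a r =>
      rw [LinearMap.comp_apply, LinearMap.comp_apply, LinearMap.lTensor_tmul, galoisMap_tmul, hρ,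
        galoisAlongPair_tmul]
      induction tensorCoaction ρA ρR (a ⊗ₜ r) with
      | zero => simp
      | add y z hy hz => simp only [map_add, mul_add, hy, hz]
      | tmul z w => simp
  rw [h, LinearMap.coe_comp]
  exact ((of M.twisting).lTensor J).bijective.comp (bijective_galoisAlongPair f g hA hR)

theorem twistedCoaction_of (θ : TwistingMap k A R) (z : A ⊗[k] R) :
    twistedCoaction M ρA ρR θ (of θ z) =
      TensorProduct.map (of θ).toLinearMap (of M.twisting).toLinearMap
        (tensorCoaction ρA ρR z) := rfl

theorem twistedCoaction_mulMap (θ : TwistingMap k A R) (z : A ⊗[k] R) :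
    twistedCoaction M ρA ρR θ (mulMap (inl θ) (inr θ) z) =
      TensorProduct.map (mulMap (inl θ) (inr θ)) (of M.twisting).toLinearMap
        (tensorCoaction ρA ρR z) := by
  have h : mulMap (inl θ) (inr θ) = (of θ).toLinearMap := LinearMap.ext (mulMap_inl_inr θ)
  rw [h]
  rfl

theorem twistedCoaction_of_tmul (θ : TwistingMap k A R) (a : A) (r : R) :
    twistedCoaction M ρA ρR θ (of θ (a ⊗ₜ r)) =
      Algebra.TensorProduct.map (inl θ) (inl M.twisting) (ρA a) *
        Algebra.TensorProduct.map (inr θ) (inr M.twisting) (ρR r) := by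
  rw [← map_mulMap_tensorCoaction, ← twistedCoaction_mulMap, mulMap_inl_inr]

end Coaction

/-! ### Twisted tensor products are Galois objects -/

section TwistedGalois

variable {k : Type*} [Field k] {H U : Type*} [Ring H] [HopfAlgebra k H] [Ring U] [HopfAlgebra k U]
  {M : MatchedPair k H U}
  {A R : Type*} [Ring A] [Algebra k A] [Ring R] [Algebra k R]
  {ρA : A →ₗ[k] A ⊗[k] H} {ρR : R →ₗ[k] R ⊗[k] U} {θ : TwistingMap k A R}

open TwistedTensor BicrossedProduct

/-- The projection applies the counit to `a₍₁₎`, and the counit axiom for `A` leaves the coaction of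
`R` alone. -/
theorem projRight_twistedCoaction (hA : IsComoduleAlgebra ρA) (z : A ⊗[k] R) :
    (projRight M).lTensor _ (twistedCoaction M ρA ρR θ (of θ z)) =
      (of θ).toLinearMap.rTensor U ((TensorProduct.assoc k A R U).symm (ρR.lTensor A z)) := by
  have h : ∀ (y : A ⊗[k] H) (y' : R ⊗[k] U), (projRight M).lTensor (TwistedTensor θ)
      (TensorProduct.map (of θ).toLinearMap (of M.twisting).toLinearMap
        (TensorProduct.tensorTensorTensorComm k A H R U (y ⊗ₜ y'))) =
      (of θ).toLinearMap.rTensor U ((TensorProduct.assoc k A R U).symm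
        (TensorProduct.rid k A (Coalgebra.counit.lTensor A y) ⊗ₜ y')) := by
    intro y y'
    induction y with
    | zero => simp
    | add x y hx hy => simp only [map_add, TensorProduct.add_tmul, hx, hy]
    | tmul p h =>
      induction y' with
      | zero => simp
      | add x y hx hy => simp only [map_add, TensorProduct.tmul_add, hx, hy]
      | tmul q u => simp [← TensorProduct.smul_tmul']
  induction z with
  | zero => simp
  | add x y hx hy => simp only [map_add, hx, hy]
  | tmul a r =>
    have h' : Coalgebra.counit.lTensor A (ρA a) = a ⊗ₜ 1 := LinearMap.congr_fun hA.counit a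
    rw [twistedCoaction_of, tensorCoaction_tmul, h, h', LinearMap.lTensor_tmul,
      TensorProduct.rid_tmul, one_smul]

theorem projLeft_twistedCoaction (hR : IsComoduleAlgebra ρR) (z : A ⊗[k] R) :
    (projLeft M).lTensor _ (twistedCoaction M ρA ρR θ (of θ z)) =
      (of θ).toLinearMap.rTensor H (TensorProduct.rightComm k A H R (ρA.rTensor R z)) := by
  have h : ∀ (y : A ⊗[k] H) (y' : R ⊗[k] U), (projLeft M).lTensor (TwistedTensor θ)
      (TensorProduct.map (of θ).toLinearMap (of M.twisting).toLinearMap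
        (TensorProduct.tensorTensorTensorComm k A H R U (y ⊗ₜ y'))) =
      (of θ).toLinearMap.rTensor H (TensorProduct.rightComm k A H R
        (y ⊗ₜ TensorProduct.rid k R (Coalgebra.counit.lTensor R y'))) := by
    intro y y'
    induction y with
    | zero => simp
    | add x y hx hy => simp only [map_add, TensorProduct.add_tmul, hx, hy]
    | tmul p h =>
      induction y' with
      | zero => simp
      | add x y hx hy => simp only [map_add, TensorProduct.tmul_add, hx, hy]
      | tmul q u => simp
  induction z with
  | zero => simp
  | add x y hx hy => simp only [map_add, hx, hy]
  | tmul a r =>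
    have h' : Coalgebra.counit.lTensor R (ρR r) = r ⊗ₜ 1 := LinearMap.congr_fun hR.counit r
    rw [twistedCoaction_of, tensorCoaction_tmul, h, h', LinearMap.rTensor_tmul,
      TensorProduct.rid_tmul, one_smul]

/-- Trivial coinvariants in the form of an exact sequence `k → A → A ⊗ H`, which remains exact after
tensoring with `R`. -/
theorem IsGaloisObject.exact_coinvariants (hA : IsGaloisObject ρA) :
    Function.Exact (Algebra.linearMap k A) (ρA - (TensorProduct.mk k A H).flip 1) := by
  intro a
  have h : a ∈ coinvariants ρA ↔ a ∈ LinearMap.range (Algebra.linearMap k A) := by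
    rw [hA.coinvariants_eq]
  rw [LinearMap.sub_apply, sub_eq_zero]
  exact h

theorem lTensor_sub_eq_zero (hA : IsComoduleAlgebra ρA) {z : A ⊗[k] R}
    (h : (projRight M).lTensor _ (twistedCoaction M ρA ρR θ (of θ z)) = of θ z ⊗ₜ 1) :
    (ρR - (TensorProduct.mk k R U).flip 1).lTensor A z = 0 := by
  rw [projRight_twistedCoaction hA] at h
  have e : of θ z ⊗ₜ[k] (1 : U) = (of θ).toLinearMap.rTensor U ((TensorProduct.assoc k A R U).symm
      (((TensorProduct.mk k R U).flip 1).lTensor A z)) := by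
    clear h
    induction z with
    | zero => simp
    | add x y hx hy => simp only [map_add, TensorProduct.add_tmul, hx, hy]
    | tmul a r => simp
  rw [e] at h
  rw [LinearMap.lTensor_sub, LinearMap.sub_apply, sub_eq_zero]
  exact (TensorProduct.assoc k A R U).symm.injective
    (rTensor_injective _ (of θ).injective h)

theorem rTensor_sub_eq_zero (hR : IsComoduleAlgebra ρR) {z : A ⊗[k] R}
    (h : (projLeft M).lTensor _ (twistedCoaction M ρA ρR θ (of θ z)) = of θ z ⊗ₜ 1) :
    (ρA - (TensorProduct.mk k A H).flip 1).rTensor R z = 0 := by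
  rw [projLeft_twistedCoaction hR] at h
  have e : of θ z ⊗ₜ[k] (1 : H) = (of θ).toLinearMap.rTensor H (TensorProduct.rightComm k A H R
      (((TensorProduct.mk k A H).flip 1).rTensor R z)) := by
    clear h
    induction z with
    | zero => simp
    | add x y hx hy => simp only [map_add, TensorProduct.add_tmul, hx, hy]
    | tmul a r => simp
  rw [e] at h
  rw [LinearMap.rTensor_sub, LinearMap.sub_apply, sub_eq_zero]
  exact (TensorProduct.rightComm k A H R).injective
    (rTensor_injective _ (of θ).injective h)

theorem twistedCoaction_inl (hR : IsComoduleAlgebra ρR) (a : A) :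
    twistedCoaction M ρA ρR θ (inl θ a) =
      TensorProduct.map (inl θ).toLinearMap (inl M.twisting).toLinearMap (ρA a) := by
  rw [inl_apply, twistedCoaction_of_tmul, hR.map_one, map_one, mul_one]
  rfl

theorem twistedCoaction_inr (hA : IsComoduleAlgebra ρA) (r : R) :
    twistedCoaction M ρA ρR θ (inr θ r) =
      TensorProduct.map (inr θ).toLinearMap (inr M.twisting).toLinearMap (ρR r) := by
  rw [inr_apply, twistedCoaction_of_tmul, hA.map_one, map_one, one_mul]
  rfl

theorem projRight_twistedCoaction_inl (hA : IsComoduleAlgebra ρA) (hR : IsComoduleAlgebra ρR)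
    (a : A) : (projRight M).lTensor _ (twistedCoaction M ρA ρR θ (inl θ a)) = inl θ a ⊗ₜ 1 := by
  rw [inl_apply, projRight_twistedCoaction hA, LinearMap.lTensor_tmul, hR.map_one]
  simp [Algebra.TensorProduct.one_def]

theorem projLeft_twistedCoaction_inr (hA : IsComoduleAlgebra ρA) (hR : IsComoduleAlgebra ρR)
    (r : R) : (projLeft M).lTensor _ (twistedCoaction M ρA ρR θ (inr θ r)) = inr θ r ⊗ₜ 1 := by
  rw [inr_apply, projLeft_twistedCoaction hR, LinearMap.rTensor_tmul, hA.map_one]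
  simp [Algebra.TensorProduct.one_def]

/-- Coinvariance along `H ⋈ U → U` puts `z` in the kernel of `id_A ⊗ (ρR - (-) ⊗ 1)`, which is `A ⊗
k`. This recognizes `A` inside `A #_θ R` from the coaction alone. -/
theorem mem_range_inl (hA : IsComoduleAlgebra ρA) (hR : IsGaloisObject ρR) {z : TwistedTensor θ}
    (h : (projRight M).lTensor _ (twistedCoaction M ρA ρR θ z) = z ⊗ₜ 1) :
    z ∈ (inl θ).range := by
  obtain ⟨z, rfl⟩ := (of θ).surjective z
  obtain ⟨w, rfl⟩ := (Module.Flat.lTensor_exact A hR.exact_coinvariants z).1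
    (lTensor_sub_eq_zero hA h)
  clear h
  induction w with
  | zero => simp
  | add x y hx hy => simpa only [map_add] using (inl θ).range.add_mem hx hy
  | tmul a c =>
    refine ⟨c • a, ?_⟩
    rw [LinearMap.lTensor_tmul, Algebra.linearMap_apply, Algebra.algebraMap_eq_smul_one,
      ← TensorProduct.smul_tmul]
    rfl

theorem mem_range_inr (hA : IsGaloisObject ρA) (hR : IsComoduleAlgebra ρR) {z : TwistedTensor θ}
    (h : (projLeft M).lTensor _ (twistedCoaction M ρA ρR θ z) = z ⊗ₜ 1) :
    z ∈ (inr θ).range := by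
  obtain ⟨z, rfl⟩ := (of θ).surjective z
  obtain ⟨w, rfl⟩ := (Module.Flat.rTensor_exact R hA.exact_coinvariants z).1
    (rTensor_sub_eq_zero hR h)
  clear h
  induction w with
  | zero => simp
  | add x y hx hy => simpa only [map_add] using (inr θ).range.add_mem hx hy
  | tmul c r =>
    refine ⟨c • r, ?_⟩
    rw [LinearMap.rTensor_tmul, Algebra.linearMap_apply, Algebra.algebraMap_eq_smul_one,
      TensorProduct.smul_tmul]
    rfl

set_option maxHeartbeats 1000000 in
-- Both sides are the same rearrangement `W` applied to the corresponding iterated coactions of `A`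
-- and `R`, so coassociativity holds factor by factor; surjectivity of `p` carries it over to `J`.
theorem coassoc_of_tensorCoaction {J E : Type*} [AddCommGroup J] [Module k J] [AddCommGroup E]
    [Module k E] [Coalgebra k E] {p : A ⊗[k] R →ₗ[k] J} (hp : Function.Surjective p)
    {e : H ⊗[k] U →ₗ[k] E} (he : ∀ z, Coalgebra.comul (R := k) (e z) =
      TensorProduct.map e e (Coalgebra.comul (R := k) z))
    {ρ : J →ₗ[k] J ⊗[k] E} (hρ : ∀ z, ρ (p z) = TensorProduct.map p e (tensorCoaction ρA ρR z))
    (hA : IsComoduleAlgebra ρA) (hR : IsComoduleAlgebra ρR) :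
    (TensorProduct.assoc k J E E).toLinearMap ∘ₗ ρ.rTensor E ∘ₗ ρ =
      Coalgebra.comul.lTensor J ∘ₗ ρ := by
  let W : (A ⊗[k] (H ⊗[k] H)) ⊗[k] (R ⊗[k] (U ⊗[k] U)) →ₗ[k] J ⊗[k] (E ⊗[k] E) :=
    TensorProduct.map p
      (TensorProduct.map e e ∘ₗ (TensorProduct.tensorTensorTensorComm k H H U U).toLinearMap) ∘ₗ
      (TensorProduct.tensorTensorTensorComm k A (H ⊗[k] H) R (U ⊗[k] U)).toLinearMap
  have h1 : ∀ (y : A ⊗[k] H) (y' : R ⊗[k] U),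
      TensorProduct.assoc k J E E (ρ.rTensor E (TensorProduct.map p e
          (TensorProduct.tensorTensorTensorComm k A H R U (y ⊗ₜ y')))) =
      W (TensorProduct.assoc k A H H (ρA.rTensor H y) ⊗ₜ
        TensorProduct.assoc k R U U (ρR.rTensor U y')) := by
    intro y y'
    induction y with
    | zero => simp
    | add x y hx hy => simp only [map_add, TensorProduct.add_tmul, hx, hy]
    | tmul a h =>
      induction y' with
      | zero => simp
      | add x y hx hy => simp only [map_add, TensorProduct.tmul_add, hx, hy]
      | tmul r u =>
        simp only [TensorProduct.tensorTensorTensorComm_tmul, TensorProduct.map_tmul,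
          LinearMap.rTensor_tmul, hρ, tensorCoaction_tmul]
        induction ρA a with
        | zero => simp
        | add x y hx hy => simp only [map_add, TensorProduct.add_tmul, hx, hy]
        | tmul a h' =>
          induction ρR r with
          | zero => simp
          | add x y hx hy =>
            simp only [map_add, TensorProduct.tmul_add, TensorProduct.add_tmul, hx, hy]
          | tmul r u' => simp [W]
  have h2 : ∀ (y : A ⊗[k] H) (y' : R ⊗[k] U),
      Coalgebra.comul.lTensor J (TensorProduct.map p e
          (TensorProduct.tensorTensorTensorComm k A H R U (y ⊗ₜ y'))) =
      W (Coalgebra.comul.lTensor A y ⊗ₜ Coalgebra.comul.lTensor R y') := by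
    intro y y'
    induction y with
    | zero => simp
    | add x y hx hy => simp only [map_add, TensorProduct.add_tmul, hx, hy]
    | tmul a h =>
      induction y' with
      | zero => simp
      | add x y hx hy => simp only [map_add, TensorProduct.tmul_add, hx, hy]
      | tmul r u =>
        simp only [TensorProduct.tensorTensorTensorComm_tmul, TensorProduct.map_tmul,
          LinearMap.lTensor_tmul, he, TensorProduct.comul_tmul]
        induction Coalgebra.comul (R := k) h with
        | zero => simp
        | add x y hx hy =>
          simp only [map_add, TensorProduct.tmul_add, TensorProduct.add_tmul, hx, hy]
        | tmul h h' =>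
          induction Coalgebra.comul (R := k) u with
          | zero => simp
          | add x y hx hy => simp only [map_add, TensorProduct.tmul_add, hx, hy]
          | tmul u u' => simp [W]
  have key : ((TensorProduct.assoc k J E E).toLinearMap ∘ₗ ρ.rTensor E ∘ₗ ρ) ∘ₗ p =
      (Coalgebra.comul.lTensor J ∘ₗ ρ) ∘ₗ p := by
    refine TensorProduct.ext' fun a r => ?_
    have hA' : TensorProduct.assoc k A H H (ρA.rTensor H (ρA a)) =
      Coalgebra.comul.lTensor A (ρA a) := LinearMap.congr_fun hA.coassoc a
    have hR' : TensorProduct.assoc k R U U (ρR.rTensor U (ρR r)) =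
      Coalgebra.comul.lTensor R (ρR r) := LinearMap.congr_fun hR.coassoc r
    simp only [LinearMap.comp_apply, LinearEquiv.coe_coe]
    rw [hρ, tensorCoaction_tmul, h1, h2, hA', hR']
  exact (LinearMap.cancel_right hp).1 key

theorem twistedCoaction_coassoc (hA : IsComoduleAlgebra ρA) (hR : IsComoduleAlgebra ρR) :
    (TensorProduct.assoc k (TwistedTensor θ) (BicrossedProduct M) (BicrossedProduct M)).toLinearMap
        ∘ₗ (twistedCoaction M ρA ρR θ).rTensor (BicrossedProduct M) ∘ₗ
        twistedCoaction M ρA ρR θ =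
      Coalgebra.comul.lTensor (TwistedTensor θ) ∘ₗ twistedCoaction M ρA ρR θ :=
  coassoc_of_tensorCoaction (of θ).surjective (comul_of M) (twistedCoaction_of θ) hA hR

theorem twistedCoaction_counit (hA : IsComoduleAlgebra ρA) (hR : IsComoduleAlgebra ρR) :
    Coalgebra.counit.lTensor _ ∘ₗ twistedCoaction M ρA ρR θ =
      (TensorProduct.mk k (TwistedTensor θ) k).flip 1 := by
  have h : ∀ (y : A ⊗[k] H) (y' : R ⊗[k] U),
      Coalgebra.counit.lTensor _
        (TensorProduct.map (of θ).toLinearMap (of M.twisting).toLinearMap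
          (TensorProduct.tensorTensorTensorComm k A H R U (y ⊗ₜ y'))) =
      of θ (TensorProduct.rid k A (Coalgebra.counit.lTensor A y) ⊗ₜ
        TensorProduct.rid k R (Coalgebra.counit.lTensor R y')) ⊗ₜ[k] (1 : k) := by
    intro y y'
    have hs : ∀ (c : k) (x : TwistedTensor θ), x ⊗ₜ[k] c = c • (x ⊗ₜ[k] (1 : k)) := fun c x => by
      rw [← TensorProduct.tmul_smul, smul_eq_mul, mul_one]
    induction y with
    | zero => simp
    | add x y hx hy => simp only [map_add, TensorProduct.add_tmul, hx, hy]
    | tmul p h =>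
      induction y' with
      | zero => simp
      | add x y hx hy => simp only [map_add, TensorProduct.tmul_add, TensorProduct.add_tmul, hx, hy]
      | tmul q u =>
        simp only [TensorProduct.tensorTensorTensorComm_tmul, TensorProduct.map_tmul,
          LinearMap.lTensor_tmul, LinearEquiv.coe_coe, counit_of, TensorProduct.counit_tmul,
          TensorProduct.rid_tmul, TensorProduct.tmul_smul, ← TensorProduct.smul_tmul', map_smul,
          smul_smul]
        rw [hs (Coalgebra.counit h), smul_smul]
  refine LinearMap.ext fun z => ?_
  obtain ⟨z, rfl⟩ := (of θ).surjective z
  induction z with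
  | zero => simp
  | add x y hx hy => simp only [map_add, hx, hy]
  | tmul a r =>
    have hA' : Coalgebra.counit.lTensor A (ρA a) = a ⊗ₜ 1 := LinearMap.congr_fun hA.counit a
    have hR' : Coalgebra.counit.lTensor R (ρR r) = r ⊗ₜ 1 := LinearMap.congr_fun hR.counit r
    rw [LinearMap.comp_apply, twistedCoaction_of, tensorCoaction_tmul, h, hA', hR']
    simp

/-- Write `(a # r)(b # s) = a · (r b) · s`. Left multiplication by `A` and right multiplication by
`R` are respected because `ρA` and `ρR` are multiplicative; the middle product is exactly where
compatibility of `θ` enters. -/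
theorem twistedCoaction_mul (hA : IsComoduleAlgebra ρA) (hR : IsComoduleAlgebra ρR)
    (hθ : IsCompatible M ρA ρR θ) (z w : TwistedTensor θ) :
    twistedCoaction M ρA ρR θ (z * w) =
      twistedCoaction M ρA ρR θ z * twistedCoaction M ρA ρR θ w := by
  have hl : ∀ a z, twistedCoaction M ρA ρR θ (inl θ a * z) =
      Algebra.TensorProduct.map (inl θ) (inl M.twisting) (ρA a) *
        twistedCoaction M ρA ρR θ z := by
    intro a z
    obtain ⟨z, rfl⟩ := (of θ).surjective z
    induction z with
    | zero => simp
    | add x y hx hy => simp only [map_add, mul_add, hx, hy]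
    | tmul b s =>
      rw [← mulMap_inl_inr, mulMap_tmul, ← mul_assoc, ← map_mul, ← mulMap_tmul, ← mulMap_tmul,
        mulMap_inl_inr, mulMap_inl_inr, twistedCoaction_of_tmul, twistedCoaction_of_tmul,
        hA.map_mul, map_mul, mul_assoc]
  have hr : ∀ s z, twistedCoaction M ρA ρR θ (z * inr θ s) =
      twistedCoaction M ρA ρR θ z *
        Algebra.TensorProduct.map (inr θ) (inr M.twisting) (ρR s) := by
    intro s z
    obtain ⟨z, rfl⟩ := (of θ).surjective z
    induction z with
    | zero => simp
    | add x y hx hy => simp only [map_add, add_mul, hx, hy]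
    | tmul b t =>
      rw [← mulMap_inl_inr, mulMap_tmul, mul_assoc, ← map_mul, ← mulMap_tmul, ← mulMap_tmul,
        mulMap_inl_inr, mulMap_inl_inr, twistedCoaction_of_tmul, twistedCoaction_of_tmul,
        hR.map_mul, map_mul, mul_assoc]
  have hm : ∀ r b, twistedCoaction M ρA ρR θ (inr θ r * inl θ b) =
      Algebra.TensorProduct.map (inr θ) (inr M.twisting) (ρR r) *
        Algebra.TensorProduct.map (inl θ) (inl M.twisting) (ρA b) := by
    intro r b
    have h : tensorCoaction ρA ρR (θ.toLinearMap (r ⊗ₜ b)) =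
      TensorProduct.map θ.toLinearMap M.omega (tensorCoaction ρR ρA (r ⊗ₜ b)) :=
      LinearMap.congr_fun hθ (r ⊗ₜ b)
    have e : mulMap (inr θ) (inl θ) = (of θ).toLinearMap ∘ₗ θ.toLinearMap :=
      TensorProduct.ext' fun r a => (of_twist θ r a).symm
    rw [← of_twist, twistedCoaction_of, h, ← map_mulMap_omega_tensorCoaction, e,
      TensorProduct.map_comp]
    rfl
  obtain ⟨z, rfl⟩ := (of θ).surjective z
  obtain ⟨w, rfl⟩ := (of θ).surjective w
  induction z with
  | zero => simp
  | add x y hx hy => simp only [map_add, add_mul, hx, hy]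
  | tmul a r =>
    induction w with
    | zero => simp
    | add x y hx hy => simp only [map_add, mul_add, hx, hy]
    | tmul b s =>
      rw [twistedCoaction_of_tmul, twistedCoaction_of_tmul, ← mulMap_inl_inr θ (a ⊗ₜ r),
        ← mulMap_inl_inr θ (b ⊗ₜ s), mulMap_tmul, mulMap_tmul, mul_assoc, hl, ← mul_assoc, hr, hm]
      simp only [mul_assoc]

/-- The twisted tensor product of Galois objects along a compatible twisting map is a Galois object
over the bicrossed product. -/
theorem isGaloisObject_twistedCoaction (hA : IsGaloisObject ρA) (hR : IsGaloisObject ρR)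
    (hθ : IsCompatible M ρA ρR θ) : IsGaloisObject (twistedCoaction M ρA ρR θ) := by
  have := hA.nontrivial
  have := hR.nontrivial
  have hm : Function.Bijective (mulMap (inl θ) (inr θ)) := by
    have h : mulMap (inl θ) (inr θ) = (of θ).toLinearMap := LinearMap.ext (mulMap_inl_inr θ)
    rw [h]
    exact (of θ).bijective
  have h1 : twistedCoaction M ρA ρR θ 1 = 1 := by
    rw [one_eq, twistedCoaction_of_tmul, hA.map_one, hR.map_one, map_one, map_one, one_mul]
  refine { coassoc := twistedCoaction_coassoc hA.toIsComoduleAlgebra hR.toIsComoduleAlgebra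
           counit := twistedCoaction_counit hA.toIsComoduleAlgebra hR.toIsComoduleAlgebra
           map_one := h1
           map_mul := twistedCoaction_mul hA.toIsComoduleAlgebra hR.toIsComoduleAlgebra hθ
           nontrivial := (inl_injective θ).nontrivial
           coinvariants_eq := ?_, bijective := ?_ }
  · ext z
    constructor
    · intro h
      have h' : twistedCoaction M ρA ρR θ z = z ⊗ₜ 1 := h
      obtain ⟨z, rfl⟩ := (of θ).surjective z
      -- The projection to `H` places `z` in `k ⊗ R` and the projection to `U` places it in `A ⊗ k`;
      -- their intersection is `k ⊗ k`.
      obtain ⟨w, rfl⟩ := mem_range_map_of_exact (algebraMap k A).injective hA.exact_coinvariants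
        hR.exact_coinvariants z
        (rTensor_sub_eq_zero (M := M) (θ := θ) hR.toIsComoduleAlgebra
          (by rw [h', LinearMap.lTensor_tmul, projLeft_one]))
        (lTensor_sub_eq_zero (M := M) (θ := θ) hA.toIsComoduleAlgebra
          (by rw [h', LinearMap.lTensor_tmul, projRight_one]))
      clear h h'
      induction w with
      | zero => simp
      | add x y hx hy => simpa only [map_add] using Submodule.add_mem _ hx hy
      | tmul c d =>
        refine ⟨d * c, ?_⟩
        rw [TensorProduct.map_tmul, Algebra.linearMap_apply, Algebra.linearMap_apply,
          Algebra.linearMap_apply, Algebra.algebraMap_eq_smul_one, Algebra.algebraMap_eq_smul_one,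
          Algebra.algebraMap_eq_smul_one, TensorProduct.tmul_smul, ← TensorProduct.smul_tmul',
          smul_smul, map_smul, one_eq]
    · rintro ⟨c, rfl⟩
      change twistedCoaction M ρA ρR θ (algebraMap k _ c) = algebraMap k _ c ⊗ₜ 1
      rw [Algebra.algebraMap_eq_smul_one, map_smul, h1, ← TensorProduct.smul_tmul',
        Algebra.TensorProduct.one_def]
  · have hb := bijective_galoisMap_comp_mulMap hA.bijective hR.bijective
      (twistedCoaction_mulMap (M := M) (ρA := ρA) (ρR := ρR) θ)
    rw [LinearMap.coe_comp] at hb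
    exact (Function.Bijective.of_comp_iff _
      ((LinearEquiv.ofBijective _ hm).lTensor _).bijective).1 hb

end TwistedGalois

/-! ### Isomorphisms and decomposition of Galois objects -/

section Classification

variable {k : Type*} [Field k] {H U : Type*} [Ring H] [HopfAlgebra k H] [Ring U] [HopfAlgebra k U]
  {M : MatchedPair k H U}
  {A R A' R' : Type*} [Ring A] [Algebra k A] [Ring R] [Algebra k R]
  [Ring A'] [Algebra k A'] [Ring R'] [Algebra k R']
  {ρA : A →ₗ[k] A ⊗[k] H} {ρR : R →ₗ[k] R ⊗[k] U} {θ : TwistingMap k A R}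
  {ρA' : A' →ₗ[k] A' ⊗[k] H} {ρR' : R' →ₗ[k] R' ⊗[k] U} {θ' : TwistingMap k A' R'}

open TwistedTensor BicrossedProduct

/-- An isomorphism which maps a subalgebra `A` of `J` onto a subalgebra `A'` of `J'` restricts to
an isomorphism `A ≃ A'`. -/
theorem exists_algEquiv_restrict {J J' : Type*} [Ring J] [Algebra k J] [Ring J'] [Algebra k J']
    {ι : A →ₐ[k] J} (hι : Function.Injective ι) {ι' : A' →ₐ[k] J'} (hι' : Function.Injective ι')
    (Φ : J ≃ₐ[k] J') (h : ∀ a, Φ (ι a) ∈ ι'.range) (h' : ∀ a, Φ.symm (ι' a) ∈ ι.range) :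
    ∃ f : A ≃ₐ[k] A', ∀ a, ι' (f a) = Φ (ι a) := by
  let f : A →ₐ[k] A' := (AlgEquiv.ofInjective ι' hι').symm.toAlgHom.comp
    ((Φ.toAlgHom.comp ι).codRestrict _ h)
  have hf : ∀ a, ι' (f a) = Φ (ι a) := fun a => congrArg Subtype.val
    ((AlgEquiv.ofInjective ι' hι').apply_symm_apply ((Φ.toAlgHom.comp ι).codRestrict _ h a))
  refine ⟨AlgEquiv.ofBijective f ⟨fun a b hab => ?_, fun a' => ?_⟩, hf⟩
  · apply hι
    apply Φ.injective
    rw [← hf, ← hf, hab]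
  · obtain ⟨a, ha⟩ := h' a'
    refine ⟨a, hι' ?_⟩
    have ha : ι a = Φ.symm (ι' a') := ha
    rw [hf, ha, Φ.apply_symm_apply]

theorem IsColinear.symm {J J' E : Type*} [Ring J] [Algebra k J] [Ring J'] [Algebra k J']
    [Ring E] [HopfAlgebra k E] {ρ : J →ₗ[k] J ⊗[k] E} {ρ' : J' →ₗ[k] J' ⊗[k] E}
    {Φ : J ≃ₐ[k] J'} (h : IsColinear ρ ρ' Φ.toLinearMap) :
    IsColinear ρ' ρ Φ.symm.toLinearMap := by
  refine LinearMap.ext fun z => ?_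
  have h1 : ρ' (Φ (Φ.symm z)) = Φ.toLinearMap.rTensor E (ρ (Φ.symm z)) :=
    LinearMap.congr_fun h (Φ.symm z)
  rw [Φ.apply_symm_apply] at h1
  change ρ (Φ.symm z) = Φ.symm.toLinearMap.rTensor E (ρ' z)
  rw [h1, ← LinearMap.comp_apply, ← LinearMap.rTensor_comp]
  have : Φ.symm.toLinearMap ∘ₗ Φ.toLinearMap = LinearMap.id :=
    LinearMap.ext Φ.symm_apply_apply
  rw [this, LinearMap.rTensor_id, LinearMap.id_apply]

/-- Elements of `A` are coinvariant along `H ⋈ U → U`, colinear maps preserve this, and on the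
target side it characterizes `A'`. -/
theorem IsColinear.map_inl_mem_range {Φ : TwistedTensor θ ≃ₐ[k] TwistedTensor θ'}
    (hΦ : IsColinear (twistedCoaction M ρA ρR θ) (twistedCoaction M ρA' ρR' θ') Φ.toLinearMap)
    (hA : IsComoduleAlgebra ρA) (hR : IsComoduleAlgebra ρR) (hA' : IsComoduleAlgebra ρA')
    (hR' : IsGaloisObject ρR') (a : A) : Φ (inl θ a) ∈ (inl θ').range := by
  apply mem_range_inl (M := M) hA' hR'
  have h1 : twistedCoaction M ρA' ρR' θ' (Φ (inl θ a)) =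
      Φ.toLinearMap.rTensor _ (twistedCoaction M ρA ρR θ (inl θ a)) :=
    LinearMap.congr_fun hΦ (inl θ a)
  rw [h1, ← LinearMap.comp_apply, LinearMap.lTensor_comp_rTensor, ← LinearMap.rTensor_comp_lTensor,
    LinearMap.comp_apply, projRight_twistedCoaction_inl hA hR]
  rfl

theorem IsColinear.map_inr_mem_range {Φ : TwistedTensor θ ≃ₐ[k] TwistedTensor θ'}
    (hΦ : IsColinear (twistedCoaction M ρA ρR θ) (twistedCoaction M ρA' ρR' θ') Φ.toLinearMap)
    (hA : IsComoduleAlgebra ρA) (hR : IsComoduleAlgebra ρR) (hA' : IsGaloisObject ρA')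
    (hR' : IsComoduleAlgebra ρR') (r : R) : Φ (inr θ r) ∈ (inr θ').range := by
  apply mem_range_inr (M := M) hA' hR'
  have h1 : twistedCoaction M ρA' ρR' θ' (Φ (inr θ r)) =
      Φ.toLinearMap.rTensor _ (twistedCoaction M ρA ρR θ (inr θ r)) :=
    LinearMap.congr_fun hΦ (inr θ r)
  rw [h1, ← LinearMap.comp_apply, LinearMap.lTensor_comp_rTensor, ← LinearMap.rTensor_comp_lTensor,
    LinearMap.comp_apply, projLeft_twistedCoaction_inr hA hR]
  rfl

/-- Colinearity is tested in `J' ⊗ E`, into which `A' ⊗ D` embeds, and there it is the colinearity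
of `Φ`. -/
theorem isColinear_restrict {D E J J' : Type*} [Ring D] [HopfAlgebra k D] [Ring E]
    [HopfAlgebra k E] [Ring J] [Algebra k J] [Ring J'] [Algebra k J']
    {ρ : J →ₗ[k] J ⊗[k] E} {ρ' : J' →ₗ[k] J' ⊗[k] E} {ρA : A →ₗ[k] A ⊗[k] D}
    {ρA' : A' →ₗ[k] A' ⊗[k] D} {i : D →ₐ[k] E} (hi : Function.Injective i)
    {ι : A →ₐ[k] J} {ι' : A' →ₐ[k] J'} (hι' : Function.Injective ι')
    (h : ∀ a, ρ (ι a) = TensorProduct.map ι.toLinearMap i.toLinearMap (ρA a))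
    (h' : ∀ a, ρ' (ι' a) = TensorProduct.map ι'.toLinearMap i.toLinearMap (ρA' a))
    {Φ : J ≃ₐ[k] J'} (hΦ : IsColinear ρ ρ' Φ.toLinearMap) {f : A ≃ₐ[k] A'}
    (hf : ∀ a, ι' (f a) = Φ (ι a)) : IsColinear ρA ρA' f.toLinearMap := by
  refine LinearMap.ext fun a => map_injective ι'.toLinearMap hι' i.toLinearMap hi ?_
  have h1 : ρ' (Φ (ι a)) = Φ.toLinearMap.rTensor E (ρ (ι a)) := LinearMap.congr_fun hΦ (ι a)
  rw [← hf, h', h] at h1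
  refine h1.trans ?_
  have e : ι'.toLinearMap ∘ₗ f.toLinearMap = Φ.toLinearMap ∘ₗ ι.toLinearMap := LinearMap.ext hf
  rw [LinearMap.comp_apply, ← LinearMap.comp_apply (LinearMap.rTensor E _) (TensorProduct.map _ _),
    ← LinearMap.comp_apply (TensorProduct.map _ _) (LinearMap.rTensor D _),
    LinearMap.rTensor_comp_map, LinearMap.map_comp_rTensor, e]

/-- An isomorphism of the twisted tensor products comes from isomorphisms of the factors. -/
theorem exists_algEquiv_factors (hA : IsGaloisObject ρA) (hR : IsGaloisObject ρR)
    (hA' : IsGaloisObject ρA') (hR' : IsGaloisObject ρR')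
    {Φ : TwistedTensor θ ≃ₐ[k] TwistedTensor θ'}
    (hΦ : IsColinear (twistedCoaction M ρA ρR θ) (twistedCoaction M ρA' ρR' θ') Φ.toLinearMap) :
    ∃ (f : A ≃ₐ[k] A') (g : R ≃ₐ[k] R'),
      IsColinear ρA ρA' f.toLinearMap ∧ IsColinear ρR ρR' g.toLinearMap ∧
      TensorProduct.map f.toLinearMap g.toLinearMap ∘ₗ θ.toLinearMap =
        θ'.toLinearMap ∘ₗ TensorProduct.map g.toLinearMap f.toLinearMap := by
  have := hA.nontrivial
  have := hR.nontrivial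
  have := hA'.nontrivial
  have := hR'.nontrivial
  have cA := hA.toIsComoduleAlgebra
  have cR := hR.toIsComoduleAlgebra
  have cA' := hA'.toIsComoduleAlgebra
  have cR' := hR'.toIsComoduleAlgebra
  obtain ⟨f, hf⟩ := exists_algEquiv_restrict (TwistedTensor.inl_injective θ)
    (TwistedTensor.inl_injective θ') Φ (hΦ.map_inl_mem_range cA cR cA' hR')
    (hΦ.symm.map_inl_mem_range cA' cR' cA hR)
  obtain ⟨g, hg⟩ := exists_algEquiv_restrict (TwistedTensor.inr_injective θ)
    (TwistedTensor.inr_injective θ') Φ (hΦ.map_inr_mem_range cA cR hA' cR')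
    (hΦ.symm.map_inr_mem_range cA' cR' hA cR)
  refine ⟨f, g, isColinear_restrict (BicrossedProduct.inl_injective M)
    (TwistedTensor.inl_injective θ') (twistedCoaction_inl cR) (twistedCoaction_inl cR') hΦ hf,
    isColinear_restrict (BicrossedProduct.inr_injective M)
    (TwistedTensor.inr_injective θ') (twistedCoaction_inr cA) (twistedCoaction_inr cA') hΦ hg,
    TensorProduct.ext' fun r a => (of θ').injective ?_⟩
  have e : ∀ z, Φ (of θ z) = of θ' (TensorProduct.map f.toLinearMap g.toLinearMap z) := by
    intro z
    rw [← mulMap_inl_inr, ← mulMap_inl_inr]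
    induction z with
    | zero => simp
    | add x y hx hy => simp only [map_add, hx, hy]
    | tmul a r =>
      rw [mulMap_tmul, map_mul, ← hf, ← hg]
      rfl
  -- Since `θ(r ⊗ a)` is the product `r · a` in `A #_θ R`, applying the algebra map `Φ` gives `g(r)
  -- · f(a)`, which is `θ'(g(r) ⊗ f(a))`.
  rw [LinearMap.comp_apply, LinearMap.comp_apply, ← e, of_twist, map_mul, ← hf, ← hg,
    TensorProduct.map_tmul]
  exact (of_twist θ' _ _).symm

/-- Compatible isomorphisms of the factors induce an isomorphism of the twisted tensor products. -/
theorem exists_algEquiv_twistedTensor {f : A ≃ₐ[k] A'} {g : R ≃ₐ[k] R'}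
    (hf : IsColinear ρA ρA' f.toLinearMap) (hg : IsColinear ρR ρR' g.toLinearMap)
    (h : TensorProduct.map f.toLinearMap g.toLinearMap ∘ₗ θ.toLinearMap =
      θ'.toLinearMap ∘ₗ TensorProduct.map g.toLinearMap f.toLinearMap) :
    ∃ Φ : TwistedTensor θ ≃ₐ[k] TwistedTensor θ',
      IsColinear (twistedCoaction M ρA ρR θ) (twistedCoaction M ρA' ρR' θ') Φ.toLinearMap := by
  have e : ∀ z, mulMap ((inl θ').comp f.toAlgHom) ((inr θ').comp g.toAlgHom) z =
      of θ' (TensorProduct.map f.toLinearMap g.toLinearMap z) := by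
    intro z
    rw [← mulMap_inl_inr]
    induction z with
    | zero => simp
    | add x y hx hy => simp only [map_add, hx, hy]
    | tmul a r => rfl
  -- The exchange rule required for extending `f` and `g` to an algebra map is the assumed relation
  -- between `θ` and `θ'`.
  let φ : TwistedTensor θ →ₐ[k] TwistedTensor θ' :=
    lift θ ((inl θ').comp f.toAlgHom) ((inr θ').comp g.toAlgHom) fun r a => by
      rw [e]
      exact (congrArg (of θ') (LinearMap.congr_fun h (r ⊗ₜ a))).trans (of_twist θ' _ _)
  have hφ : ∀ z, φ (of θ z) = of θ' (TensorProduct.map f.toLinearMap g.toLinearMap z) := e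
  have hbij : Function.Bijective φ := by
    have : ⇑φ = of θ' ∘ TensorProduct.congr f.toLinearEquiv g.toLinearEquiv ∘ (of θ).symm :=
      funext fun z => hφ ((of θ).symm z)
    rw [this]
    exact (of θ').bijective.comp ((LinearEquiv.bijective _).comp (of θ).symm.bijective)
  refine ⟨AlgEquiv.ofBijective φ hbij, LinearMap.ext fun z => ?_⟩
  obtain ⟨z, rfl⟩ := (of θ).surjective z
  change twistedCoaction M ρA' ρR' θ' (φ (of θ z)) =
    φ.toLinearMap.rTensor _ (twistedCoaction M ρA ρR θ (of θ z))
  rw [hφ]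
  induction z with
  | zero => simp
  | add x y hx hy => simp only [map_add, hx, hy]
  | tmul a r =>
    have hf' : ρA' (f a) = f.toLinearMap.rTensor H (ρA a) := LinearMap.congr_fun hf a
    have hg' : ρR' (g r) = g.toLinearMap.rTensor U (ρR r) := LinearMap.congr_fun hg r
    rw [TensorProduct.map_tmul, AlgEquiv.toLinearMap_apply, AlgEquiv.toLinearMap_apply,
      twistedCoaction_of, twistedCoaction_of, tensorCoaction_tmul, tensorCoaction_tmul, hf', hg']
    induction ρA a with
    | zero => simp
    | add x y hx hy => simp only [map_add, TensorProduct.add_tmul, hx, hy]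
    | tmul p h =>
      induction ρR r with
      | zero => simp
      | add x y hx hy => simp only [map_add, TensorProduct.tmul_add, hx, hy]
      | tmul q u => simp [hφ]

/-- Every Galois object over a bicrossed product is a twisted tensor product of Galois objects over
the factors. -/
theorem exists_twistedTensor {J : Type w} [Ring J] [Algebra k J]
    {ρ : J →ₗ[k] J ⊗[k] BicrossedProduct M} (hρ : IsGaloisObject ρ) :
    ∃ (A R : Type w) (_ : Ring A) (_ : Algebra k A) (_ : Ring R) (_ : Algebra k R)
      (ρA : A →ₗ[k] A ⊗[k] H) (ρR : R →ₗ[k] R ⊗[k] U) (θ : TwistingMap k A R),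
      IsGaloisObject ρA ∧ IsGaloisObject ρR ∧ IsCompatible M ρA ρR θ ∧
      ∃ Φ : TwistedTensor θ ≃ₐ[k] J,
        IsColinear (twistedCoaction M ρA ρR θ) ρ Φ.toLinearMap := by
  have := hρ.nontrivial
  obtain ⟨A, ρA, hρA, hA⟩ := exists_restrict (BicrossedProduct.inl_injective M) (comul_inl M)
    hρ.toIsComoduleAlgebra
  obtain ⟨R, ρR, hρR, hR⟩ := exists_restrict (BicrossedProduct.inr_injective M) (comul_inr M)
    hρ.toIsComoduleAlgebra
  have gA : IsGaloisObject ρA := hρ.restrict (BicrossedProduct.inl_injective M) (comul_inl M)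
    (counit_inl M) (antipode_inl M) Subtype.val_injective hρA hA
  have gR : IsGaloisObject ρR := hρ.restrict (BicrossedProduct.inr_injective M) (comul_inr M)
    (counit_inr M) (antipode_inr M) Subtype.val_injective hρR hR
  have hm : ∀ z, ρ (mulMap A.val R.val z) = TensorProduct.map (mulMap A.val R.val)
      (of M.twisting).toLinearMap (tensorCoaction ρA ρR z) := by
    intro z
    induction z with
    | zero => simp
    | add x y hx hy => simp only [map_add, hx, hy]
    | tmul a r =>
      rw [map_mulMap_tensorCoaction, mulMap_tmul, hρ.map_mul, hρA, hρR]
      rfl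
  have hbij : Function.Bijective (mulMap A.val R.val) := by
    have hb := bijective_galoisMap_comp_mulMap gA.bijective gR.bijective hm
    rw [LinearMap.coe_comp] at hb
    -- Cancelling the bijective Galois map of `J` leaves `id_J ⊗ m` bijective, with `m` the
    -- multiplication map; `J ≠ 0` is faithfully flat over the field `k`.
    exact (Module.FaithfullyFlat.lTensor_bijective_iff_bijective k J _).1
      ((Function.Bijective.of_comp_iff' hρ.bijective _).1 hb)
  obtain ⟨θ, Φ, hΦ, hθ⟩ := exists_twistingMap hbij
  refine ⟨A, R, inferInstance, inferInstance, inferInstance, inferInstance, ρA, ρR, θ, gA, gR,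
    TensorProduct.ext' fun r a => ?_, Φ, LinearMap.ext fun z => ?_⟩
  -- Compatibility is checked in `J ⊗ (H ⋈ U)`: both sides become the product `ρ(r) ρ(a) = ρ(r a)`,
  -- because `ρ` is multiplicative.
  · apply map_injective _ hbij.1 _ (of M.twisting).injective
    have e : mulMap A.val R.val ∘ₗ θ.toLinearMap = mulMap R.val A.val := LinearMap.ext hθ
    rw [LinearMap.comp_apply, ← hm, hθ, mulMap_tmul, hρ.map_mul, hρA, hρR, LinearMap.comp_apply,
      ← LinearMap.comp_apply (TensorProduct.map _ _) (TensorProduct.map _ _),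
      ← TensorProduct.map_comp, e, map_mulMap_omega_tensorCoaction]
    rfl
  · obtain ⟨z, rfl⟩ := (of θ).surjective z
    have e : Φ.toLinearMap ∘ₗ (of θ).toLinearMap = mulMap A.val R.val := LinearMap.ext hΦ
    rw [LinearMap.comp_apply, LinearMap.comp_apply, twistedCoaction_of, AlgEquiv.toLinearMap_apply,
      hΦ, hm, ← LinearMap.comp_apply (LinearMap.rTensor _ _) (TensorProduct.map _ _),
      LinearMap.rTensor_comp_map, e]

end Classification

end

end HopfGalois

theorem theorem4p2 {k : Type*} [Field k] {H U : Type*} [Ring H] [HopfAlgebra k H]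
    [Ring U] [HopfAlgebra k U] (M : MatchedPair k H U) :
    -- twisted tensor products of Galois objects are Galois objects
    (∀ (A R : Type*) [Ring A] [Algebra k A] [Ring R] [Algebra k R]
      (ρA : A →ₗ[k] A ⊗[k] H) (ρR : R →ₗ[k] R ⊗[k] U) (θ : TwistingMap k A R),
      IsGaloisObject ρA → IsGaloisObject ρR → IsCompatible M ρA ρR θ →
        IsGaloisObject (twistedCoaction M ρA ρR θ)) ∧
    -- classification up to isomorphism of comodule algebras
    (∀ (A R A' R' : Type*) [Ring A] [Algebra k A] [Ring R] [Algebra k R]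
      [Ring A'] [Algebra k A'] [Ring R'] [Algebra k R']
      (ρA : A →ₗ[k] A ⊗[k] H) (ρR : R →ₗ[k] R ⊗[k] U) (θ : TwistingMap k A R)
      (ρA' : A' →ₗ[k] A' ⊗[k] H) (ρR' : R' →ₗ[k] R' ⊗[k] U) (θ' : TwistingMap k A' R'),
      IsGaloisObject ρA → IsGaloisObject ρR → IsCompatible M ρA ρR θ →
      IsGaloisObject ρA' → IsGaloisObject ρR' → IsCompatible M ρA' ρR' θ' →
        ((∃ Φ : TwistedTensor θ ≃ₐ[k] TwistedTensor θ',
            IsColinear (twistedCoaction M ρA ρR θ) (twistedCoaction M ρA' ρR' θ')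
              Φ.toLinearMap) ↔
          ∃ (f : A ≃ₐ[k] A') (g : R ≃ₐ[k] R'),
            IsColinear ρA ρA' f.toLinearMap ∧ IsColinear ρR ρR' g.toLinearMap ∧
            TensorProduct.map f.toLinearMap g.toLinearMap ∘ₗ θ.toLinearMap =
              θ'.toLinearMap ∘ₗ TensorProduct.map g.toLinearMap f.toLinearMap)) ∧
    -- every Galois object over the bicrossed product arises in this way
    (∀ (J : Type w) [Ring J] [Algebra k J] (ρJ : J →ₗ[k] J ⊗[k] BicrossedProduct M),
      IsGaloisObject ρJ →
        ∃ (A R : Type w) (_ : Ring A) (_ : Algebra k A) (_ : Ring R) (_ : Algebra k R)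
          (ρA : A →ₗ[k] A ⊗[k] H) (ρR : R →ₗ[k] R ⊗[k] U) (θ : TwistingMap k A R),
          IsGaloisObject ρA ∧ IsGaloisObject ρR ∧ IsCompatible M ρA ρR θ ∧
          ∃ Φ : TwistedTensor θ ≃ₐ[k] J,
            IsColinear (twistedCoaction M ρA ρR θ) ρJ Φ.toLinearMap) := by
  refine ⟨fun A R _ _ _ _ ρA ρR θ hA hR hθ => isGaloisObject_twistedCoaction hA hR hθ, ?_,
    fun J _ _ ρJ hJ => exists_twistedTensor hJ⟩
  intro A R A' R' _ _ _ _ _ _ _ _ ρA ρR θ ρA' ρR' θ' hA hR _ hA' hR' _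
  exact ⟨fun ⟨_, hΦ⟩ => exists_algEquiv_factors hA hR hA' hR' hΦ,
    fun ⟨_, _, hf, hg, h⟩ => exists_algEquiv_twistedTensor hf hg h⟩
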